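/- **Setting.** Let $K$ be a commutative ring, $H$ a unital associative $K$-algebra and $\tau:H\to K$ a $K$-linear map with $\tau(xy)=\tau(yx)$ for all $x,y$. For a square matrix $M$ indexed by a finite set, with entries in a ring $R$ with a central map $\tau$ to a commutative ring, put $$\det\nolimits_\tau M=\sum_{\sigma}\varepsilon(\sigma)\prod_{(i_1\cdots i_r)\preccurlyeq\sigma}\tau(M_{i_1i_2}\cdots M_{i_ri_1}),$$ where the product is over all cycles of the permutation $\sigma$, fixed points included. Let $\mathsf E$ be a set of ordered pairs of distinct elements of a finite vertex set $\{1,\dots,n\}$, let $0\le m\le n$ and $[m]=\{1,\dots,m\}$. Let $S=K[a_{ij}:(i,j)\in\mathsf E]$, put $a_{ij}=0$ if $(i,j)\notin\mathsf E$, and extend $\tau$ to an $S$-linear map $S\otimes_K H\to S$. Let $\mathscr F^{\to}_m$ be the set of oriented cycle-rooted spanning forests, i.e. of the sets $\mathsf F\subset\mathsf E$ that contain exactly one edge starting from each vertex of $[m]$ and no edge starting from another vertex. Let $\mathscr C(\mathsf F)$ be the set of simple oriented cycles of $\mathsf F$, $a_{\mathsf F}=\prod_{(i,j)\in\mathsf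 F}a_{ij}$, and let $\ell(c)$ be the length of a cycle $c$. For $h=(h_{ij})$ in $H$ and $c=(i_1\cdots i_r)$, let $h_c=h_{i_1i_2}\cdots h_{i_ri_1}$, so that $\tau(h_c)$ is well defined; $c^{-1}$ is the reversed cycle. Let $\Delta$ be the matrix with $\Delta_{ii}=\sum_j a_{ij}$ and $\Delta_{ij}=-a_{ij}h_{ij}$ for $i\ne j$, and $\Delta_{[m]}$ its principal submatrix indexed by $[m]$. For $N\ge0$ and $h_{ij}\in M_N(H)$, regard the analogous matrix $\Delta$, with blocks $\Delta_{ii}=(\sum_j a_{ij})I_N$ and $\Delta_{ij}=-a_{ij}h_{ij}$, as a matrix indexed by the coloured vertices $(i,\alpha)$, $1\le\alpha\le N$, and let $\Delta_{[Nm]}$ be its principal submatrix on $[m]\times\{1,\dots,N\}$. The coloured graph has an edge from $(i,\alpha)$ to $(j,\beta)$, of weight $a_{ij}$, for all $(i,j)\in\mathsf E$ and all $\alpha,\beta$; for a cycle $c$ of it, $\hat h_c$ is the product of the entries $(h_{ij})_{\alpha\beta}$ along $c$. Let $\mathscr F^{\to}_{m,N}$ be the set of oriented cycle-rooted spanning forests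 of the coloured graph with one edge starting from each vertex of $[m]\times\{1,\dots,N\}$ and no other edge. An edge, or a cycle, is horizontal if all its vertices have the same colour. Let $\mathscr{HF}^{\to}_{m,N}$ be the set of those $\mathsf F\in\mathscr F^{\to}_{m,N}$ all of whose edges that lie on no cycle are horizontal; $\mathscr H(\mathsf F)$ and $\mathscr S(\mathsf F)$ are the sets of horizontal and of non-horizontal cycles of $\mathsf F$. When $\mathsf E$ is symmetric, $\mathscr F_m$ and $\mathscr{HF}_{m,N}$ are the sets of equivalence classes $[\mathsf F]$ of forests up to reversal of the orientation of their cycles. **Theorem.** In (1)–(6), assume that $\tau(1)$ is invertible in $K$. 1. In $S$: $\displaystyle\det\nolimits_\tau\Delta_{[m]}=\tau(1)^m\sum_{\mathsf F\in\mathscr F^{\to}_m}a_{\mathsf F}\prod_{c\in\mathscr C(\mathsf F)}\bigl(1-\tau(1)^{-\ell(c)}\tau(h_c)\bigr).$ 2. If $\mathsf E$ is symmetric, then in $S/(a_{ij}-a_{ji}:(i,j)\in\mathsf E)$: $$\det\nolimits_\tau\Delta_{[m]}=\tau(1)^m\sum_{[\mathsf F]\in\mathscr F_m}a_{\mathsf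 F}\prod_{\substack{c\in\mathscr C(\mathsf F)\\ \ell(c)=2}}\bigl(1-\tau(1)^{-\ell(c)}\tau(h_c)\bigr)\prod_{\substack{c\in\mathscr C(\mathsf F)\\ \ell(c)\ge3}}\bigl(2-\tau(1)^{-\ell(c)}(\tau(h_c)+\tau(h_{c^{-1}}))\bigr).$$ 3. In $S$: $\displaystyle\det\nolimits_\tau\Delta_{[Nm]}=\tau(1)^{Nm}\sum_{\mathsf F\in\mathscr{HF}^{\to}_{m,N}}a_{\mathsf F}\prod_{c\in\mathscr H(\mathsf F)}\bigl(1-\tau(1)^{-\ell(c)}\tau(\hat h_c)\bigr)\prod_{c\in\mathscr S(\mathsf F)}\bigl(-\tau(1)^{-\ell(c)}\tau(\hat h_c)\bigr).$ 4. If $\mathsf E$ is symmetric, then in $S/(a_{ij}-a_{ji}:(i,j)\in\mathsf E)$, $\det_\tau\Delta_{[Nm]}$ equals $$\tau(1)^{Nm}\sum_{[\mathsf F]\in\mathscr{HF}_{m,N}}a_{\mathsf F}\prod_{\substack{c\in\mathscr H(\mathsf F)\\ \ell(c)=2}}\bigl(1-\tau(1)^{-\ell(c)}\tau(\hat h_c)\bigr)\prod_{\substack{c\in\mathscr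 H(\mathsf F)\\ \ell(c)\ge3}}\bigl(2-\tau(1)^{-\ell(c)}(\tau(\hat h_c)+\tau(\hat h_{c^{-1}}))\bigr)\prod_{\substack{c\in\mathscr S(\mathsf F)\\ \ell(c)=2}}\bigl(-\tau(1)^{-\ell(c)}\tau(\hat h_c)\bigr)\prod_{\substack{c\in\mathscr S(\mathsf F)\\ \ell(c)\ge3}}\bigl(-\tau(1)^{-\ell(c)}(\tau(\hat h_c)+\tau(\hat h_{c^{-1}}))\bigr).$$ 5. Let $d$ be a natural number invertible in $K$ and $\varepsilon_{ij}\in\{1,-1\}$; let $\varepsilon_c$ be the product of the signs along $c$, and let now $\Delta_{ii}=\frac1d\sum_j a_{ij}$ and $\Delta_{ij}=-\varepsilon_{ij}a_{ij}h_{ij}$ for $i\ne j$. Then in $S$: $$\det\nolimits_\tau\Delta_{[m]}=\Bigl[\frac{\tau(1)}d\Bigr]^m\sum_{\mathsf F\in\mathscr F^{\to}_m}a_{\mathsf F}\prod_{c\in\mathscr C(\mathsf F)}\Bigl(1-\Bigl[\frac d{\tau(1)}\Bigr]^{\ell(c)}\varepsilon_c\,\tau(h_c)\Bigr).$$ 6.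 If $N$ is invertible in $K$, then in $S$: $$\det\nolimits_\tau\Delta_{[Nm]}=\Bigl[\frac{\tau(1)}N\Bigr]^{mN}\sum_{\mathsf F\in\mathscr F^{\to}_{m,N}}a_{\mathsf F}\prod_{c\in\mathscr C(\mathsf F)}\Bigl(1-\Bigl[\frac N{\tau(1)}\Bigr]^{\ell(c)}\tau(\hat h_c)\Bigr).$$ 7. If $\tau(1)=N$ (no invertibility being assumed), then in $S$: $$\det\nolimits_\tau\Delta_{[Nm]}=\sum_{\mathsf F\in\mathscr F^{\to}_{m,N}}a_{\mathsf F}\prod_{c\in\mathscr C(\mathsf F)}\bigl(1-\tau(\hat h_c)\bigr).$$ -/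

import Mathlib

open scoped TensorProduct

noncomputable section

namespace TauDet

/-! ### Cycles and traces along cycles -/

/-- The simple cycles of a binary relation `r` on a finite set: the nonempty cyclic sequences
`(i₁ ⋯ iₗ)` of distinct elements with `r i₁ i₂`, `r i₂ i₃`, …, `r iₗ i₁`. -/
def simpleCycles {V : Type*} [Fintype V] [DecidableEq V] (r : V → V → Prop) :
    Finset (Cycle V) := by
  classical
  exact ((Finset.univ : Finset {c : Cycle V // c.Nodup}).map
    (Function.Embedding.subtype _)).filter (fun c => c ≠ Cycle.nil ∧ c.Chain r)

theorem mem_simpleCycles {V : Type*} [Fintype V] [DecidableEq V] (r : V → V → Prop)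
    (c : Cycle V) : c ∈ simpleCycles r ↔ c.Nodup ∧ c ≠ Cycle.nil ∧ c.Chain r := by
  simp [simpleCycles]

/-- The product `M i₁ i₂ * M i₂ i₃ * ⋯ * M iₗ i₁` along the list `[i₁, …, iₗ]`. -/
def closedProd {V R : Type*} [Monoid R] (M : V → V → R) (l : List V) : R :=
  (List.zipWith M l (l.rotate 1)).prod

theorem closedProd_rotate {V R S : Type*} [Monoid R] (τ : R → S)
    (hτ : ∀ x y, τ (x * y) = τ (y * x)) (M : V → V → R) (l : List V) (k : ℕ) :
    τ (closedProd M (l.rotate k)) = τ (closedProd M l) := by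
  have h : closedProd M (l.rotate k) = ((List.zipWith M l (l.rotate 1)).rotate k).prod := by
    unfold closedProd
    rw [List.zipWith_rotate_distrib _ _ _ _ (by simp), List.rotate_rotate, List.rotate_rotate,
      add_comm]
  rw [h, List.rotate_eq_drop_append_take_mod, List.prod_append, hτ, ← List.prod_append,
    List.take_append_drop]
  rfl

/-- `τ (M i₁ i₂ * M i₂ i₃ * ⋯ * M iₗ i₁)` for the cycle `c = (i₁ ⋯ iₗ)` and a central map `τ`;
by centrality it does not depend on the starting point of the cycle. -/
def cycleTrace {V R S : Type*} [Monoid R] (τ : R → S)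
    (hτ : ∀ x y, τ (x * y) = τ (y * x)) (M : V → V → R) (c : Cycle V) : S :=
  Quotient.liftOn c (fun l => τ (closedProd M l)) (by
    rintro l _ ⟨k, rfl⟩
    exact (closedProd_rotate τ hτ M l k).symm)

/-- The `τ`-determinant
`∑_σ ε(σ) ∏_{(i₁ ⋯ iᵣ) ≼ σ} τ (M i₁ i₂ ⋯ M iᵣ i₁)`, the product being over all cycles of the
permutation `σ`, including its fixed points. -/
def tauDet {ι R S : Type*} [Fintype ι] [DecidableEq ι] [Monoid R] [CommRing S] (τ : R → S)
    (hτ : ∀ x y, τ (x * y) = τ (y * x)) (M : Matrix ι ι R) : S :=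
  ∑ σ : Equiv.Perm ι, ((Equiv.Perm.sign σ : ℤ) : S) *
    ∏ c ∈ simpleCycles (fun i j => σ i = j), cycleTrace τ hτ M c

/-! ### Extension of a trace to a larger ring of scalars -/

/-- The `S`-linear extension `S ⊗ H → S` of `τ : H → K`; it sends `s ⊗ x` to `τ(x) s`. -/
def extTrace {K H : Type*} [CommRing K] [Ring H] [Algebra K H] (S : Type*) [CommRing S]
    [Algebra K S] (τ : H →ₗ[K] K) : S ⊗[K] H →ₗ[S] S :=
  (TensorProduct.AlgebraTensorModule.rid K S S).toLinearMap ∘ₗ τ.baseChange S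

theorem extTrace_tmul {K H : Type*} [CommRing K] [Ring H] [Algebra K H] (S : Type*)
    [CommRing S] [Algebra K S] (τ : H →ₗ[K] K) (s : S) (x : H) :
    extTrace S τ (s ⊗ₜ[K] x) = τ x • s := by
  simp [extTrace]

theorem extTrace_comm {K H : Type*} [CommRing K] [Ring H] [Algebra K H] (S : Type*)
    [CommRing S] [Algebra K S] (τ : H →ₗ[K] K) (hτ : ∀ x y, τ (x * y) = τ (y * x))
    (u v : S ⊗[K] H) : extTrace S τ (u * v) = extTrace S τ (v * u) := by
  induction u using TensorProduct.induction_on with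
  | zero => simp
  | add u₁ u₂ h₁ h₂ => simp only [add_mul, mul_add, map_add, h₁, h₂]
  | tmul s x =>
    induction v using TensorProduct.induction_on with
    | zero => simp
    | add v₁ v₂ h₁ h₂ => simp only [add_mul, mul_add, map_add, h₁, h₂]
    | tmul t y =>
      simp only [Algebra.TensorProduct.tmul_mul_tmul, extTrace_tmul, hτ x y, mul_comm s t]

/-! ### The ring of edge weights and the Laplacians -/

/-- The ring `S = K[a_{ij} : (i,j) ∈ E]`. -/
abbrev WeightRing {V : Type*} (K : Type*) [CommRing K] (E : Finset (V × V)) : Type _ :=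
  MvPolynomial E K

/-- The indeterminate `a_{ij}` if `(i,j)` is an edge, and `0` otherwise. -/
def edgeVar {V : Type*} [DecidableEq V] (K : Type*) [CommRing K] (E : Finset (V × V))
    (i j : V) : WeightRing K E :=
  if hij : (i, j) ∈ E then MvPolynomial.X ⟨(i, j), hij⟩ else 0

/-- The ideal `(a_{ij} - a_{ji} : (i,j) ∈ E)`. -/
def symmIdeal {V : Type*} [DecidableEq V] (K : Type*) [CommRing K] (E : Finset (V × V)) :
    Ideal (WeightRing K E) :=
  Ideal.span {p | ∃ e ∈ E, p = edgeVar K E e.1 e.2 - edgeVar K E e.2 e.1}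

/-- The twisted Laplacian, with entries in `S ⊗ H`: `Δ_{ii} = ∑_j a_{ij}` and
`Δ_{ij} = -a_{ij} h_{ij}` for `i ≠ j`. -/
def laplacian {V K H : Type*} [Fintype V] [DecidableEq V] [CommRing K] [Ring H] [Algebra K H]
    (E : Finset (V × V)) (h : V → V → H) : Matrix V V (WeightRing K E ⊗[K] H) :=
  Matrix.of fun i j =>
    if i = j then (∑ k, edgeVar K E i k) ⊗ₜ[K] (1 : H) else -(edgeVar K E i j ⊗ₜ[K] h i j)

/-- The signed twisted Laplacian: `Δ_{ii} = d⁻¹ ∑_j a_{ij}` and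
`Δ_{ij} = -ε_{ij} a_{ij} h_{ij}` for `i ≠ j`. -/
def signedLaplacian {V K H : Type*} [Fintype V] [DecidableEq V] [CommRing K] [Ring H]
    [Algebra K H] (E : Finset (V × V)) (d : Kˣ) (ε : V → V → ℤˣ) (h : V → V → H) :
    Matrix V V (WeightRing K E ⊗[K] H) :=
  Matrix.of fun i j =>
    if i = j then (MvPolynomial.C (↑d⁻¹ : K) * ∑ k, edgeVar K E i k) ⊗ₜ[K] (1 : H)
    else -((((ε i j : ℤ) : WeightRing K E) * edgeVar K E i j) ⊗ₜ[K] h i j)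

/-- The holonomies of the coloured edges: the edge from `(i, α)` to `(j, β)` carries the entry
`(α, β)` of the matrix `h_{ij}`. -/
def colouredHol {V H : Type*} {N : ℕ} (h : V → V → Matrix (Fin N) (Fin N) H) :
    V × Fin N → V × Fin N → H :=
  fun p q => h p.1 q.1 p.2 q.2

/-- The twisted Laplacian with matrix holonomies, seen as a block matrix with `N × N` blocks:
the diagonal blocks are `(∑_j a_{ij}) I_N`, the off-diagonal blocks are `-a_{ij} h_{ij}`. -/
def blockLaplacian {V K H : Type*} [Fintype V] [DecidableEq V] [CommRing K] [Ring H]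
    [Algebra K H] (E : Finset (V × V)) {N : ℕ} (h : V → V → Matrix (Fin N) (Fin N) H) :
    Matrix (V × Fin N) (V × Fin N) (WeightRing K E ⊗[K] H) :=
  Matrix.of fun p q =>
    if p.1 = q.1 then
      (if p.2 = q.2 then (∑ k, edgeVar K E p.1 k) ⊗ₜ[K] (1 : H) else 0)
    else -(edgeVar K E p.1 q.1 ⊗ₜ[K] colouredHol h p q)

/-! ### Oriented cycle-rooted spanning forests -/

/-- The oriented cycle-rooted spanning forests of the directed graph `(V, E)` with interior `W`:
the sets `F ⊆ E` of edges that contain exactly one edge starting from each vertex of `W` and no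
edge starting from a vertex outside `W`. Following the edges of `F` from any vertex, one ends
either in a cycle of `F` or at a vertex outside `W`. -/
def forests {V : Type*} [DecidableEq V] (E : Finset (V × V)) (W : Finset V) :
    Finset (Finset (V × V)) := by
  classical
  exact E.powerset.filter (fun F => (∀ e ∈ F, e.1 ∈ W) ∧ ∀ i ∈ W, ∃! e, e ∈ F ∧ e.1 = i)

/-- The set of the cycles of a set of directed edges. -/
def cyclesOf {V : Type*} [Fintype V] [DecidableEq V] (F : Finset (V × V)) :
    Finset (Cycle V) :=
  simpleCycles (fun i j => (i, j) ∈ F)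

/-- The edges of the coloured graph: all `((i, α), (j, β))` with `(i, j) ∈ E`. -/
def colouredEdges {V : Type*} [Fintype V] [DecidableEq V] (E : Finset (V × V)) (N : ℕ) :
    Finset ((V × Fin N) × (V × Fin N)) :=
  Finset.univ.filter (fun e => (e.1.1, e.2.1) ∈ E)

/-- The oriented cycle-rooted spanning forests of the coloured graph, with interior
`W × {1, …, N}`. -/
def colouredForests {V : Type*} [Fintype V] [DecidableEq V] (E : Finset (V × V))
    (W : Finset V) (N : ℕ) : Finset (Finset ((V × Fin N) × (V × Fin N))) :=
  forests (colouredEdges E N) (W ×ˢ Finset.univ)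

/-- The coloured forests in which every edge that lies on no cycle is horizontal, that is, joins
two vertices of the same colour. (The only edge of a forest starting from a vertex of one of its
cycles is the edge of this cycle.) -/
def horizontalForests {V : Type*} [Fintype V] [DecidableEq V] (E : Finset (V × V))
    (W : Finset V) (N : ℕ) : Finset (Finset ((V × Fin N) × (V × Fin N))) := by
  classical
  exact (colouredForests E W N).filter
    (fun F => ∀ e ∈ F, (∀ c ∈ cyclesOf F, e.1 ∉ c) → e.1.2 = e.2.2)

/-- A cycle of the coloured graph is horizontal if all its vertices have the same colour. -/
def IsHorizontal {V : Type*} {N : ℕ} (c : Cycle (V × Fin N)) : Prop :=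
  ∀ p ∈ c, ∀ q ∈ c, p.2 = q.2

/-- The horizontal cycles of a coloured forest. -/
def horizontalCycles {V : Type*} [Fintype V] [DecidableEq V] {N : ℕ}
    (F : Finset ((V × Fin N) × (V × Fin N))) : Finset (Cycle (V × Fin N)) := by
  classical
  exact (cyclesOf F).filter IsHorizontal

/-- The non-horizontal (slanted) cycles of a coloured forest. -/
def slantedCycles {V : Type*} [Fintype V] [DecidableEq V] {N : ℕ}
    (F : Finset ((V × Fin N) × (V × Fin N))) : Finset (Cycle (V × Fin N)) := by
  classical
  exact (cyclesOf F).filter (fun c => ¬ IsHorizontal c)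

/-- The weight `a_F = ∏_{(i,j) ∈ F} a_{ij}` of a set of edges. -/
def forestWeight {V : Type*} [DecidableEq V] (K : Type*) [CommRing K] (E : Finset (V × V))
    (F : Finset (V × V)) : WeightRing K E :=
  ∏ e ∈ F, edgeVar K E e.1 e.2

/-- The weight `a_F` of a set of coloured edges, an edge from `(i, α)` to `(j, β)` having
weight `a_{ij}`. -/
def colouredForestWeight {V : Type*} [DecidableEq V] (K : Type*) [CommRing K]
    (E : Finset (V × V)) {N : ℕ} (F : Finset ((V × Fin N) × (V × Fin N))) :
    WeightRing K E :=
  ∏ e ∈ F, edgeVar K E e.1.1 e.2.1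

/-- The sign `ε_c`, the product of the signs `ε_{ij}` along the cycle. -/
def cycleSign {V : Type*} (ε : V → V → ℤˣ) (c : Cycle V) : ℤˣ :=
  cycleTrace (fun x : ℤˣ => x) (fun x y => mul_comm x y) ε c

/-! ### Forests up to the orientation of their cycles -/

/-- The set of edges obtained from `F` by reversing those that start on the cycle `c`; if `F` is
a forest and `c` one of its cycles, these are the edges of `c`. -/
def reverseAlong {V : Type*} [DecidableEq V] (F : Finset (V × V)) (c : Cycle V) :
    Finset (V × V) := by
  classical
  exact F.filter (fun e => e.1 ∉ c) ∪ (F.filter (fun e => e.1 ∈ c)).image Prod.swap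

/-- The equivalence relation on a set of forests generated by the reversal of one cycle. -/
def reversalSetoid {V : Type*} [Fintype V] [DecidableEq V] (P : Finset (Finset (V × V))) :
    Setoid P :=
  Relation.EqvGen.setoid (fun F F' : P => ∃ c ∈ cyclesOf F.1, F'.1 = reverseAlong F.1 c)

/-- The set of the forests of `P` considered up to the orientation of their cycles. -/
abbrev Unoriented {V : Type*} [Fintype V] [DecidableEq V] (P : Finset (Finset (V × V))) :
    Type _ :=
  Quotient (reversalSetoid P)

instance {V : Type*} [Fintype V] [DecidableEq V] (P : Finset (Finset (V × V))) :
    Fintype (Unoriented P) :=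
  Fintype.ofFinite _

end TauDet

end

noncomputable section

namespace TauDet

/-! ### Chains along cycles -/

/-! Expand the determinant over permutations `σ`. A cycle of length `r ≥ 2` in `σ` has sign
`-(-1)^r`, and its `r` off-diagonal entries `-a h` bring another `(-1)^r`. So it contributes exactly
`-τ(h_c) a_c`, where `a_c` is the product of the weights along it. A fixed point `i` contributes the
row sum `τ(1) ∑_j a_{ij}`. Expanding the row sums amounts to choosing an outgoing edge at every
fixed point; together with `σ` on the moved points this gives a map `f`, whose graph is a
cycle-rooted spanning forest.

Now exchange the sums and fix `f`. The permutations that produce `f` are those obtained by keeping a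
subset of the cycles of `f` and fixing every other point. Each cycle of `f` thus contributes either
its trace term or the product of its row weights, independently of the other cycles, so the sum over
subsets factors as a product over cycles of (trace term + weight term). This is
`sum_perm_compatible`; the exchange is `sum_perm_eq_sum_forests`, and the passage from `tauDet` is
`tauDet_eq_sum_forests`.

For matrix holonomies the same argument runs on the coloured graph, where the diagonal entry can be
spread over the coloured edges in two ways. Over edges that keep the colour, with factor `τ(1)`, it
yields horizontal branches, and a slanted cycle loses its weight term. Over all coloured edges, with
a factor `s` such that `s N = τ(1)`, it yields all coloured forests. Both are instances of
`sum_forests_uniform`, with a predicate `P` selecting the edges.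

For symmetric weights, reversing a cycle changes neither the forest weight nor the branches. An
equivalence class is a free choice of orientation for each cycle of length at least 3 (a 2-cycle is
its own reverse), so the sum over a class factors again, into `φ(c) + φ(c⁻¹)`; this is
`sum_class_eq`. -/

theorem chain_coe_iff {V : Type*} (r : V → V → Prop) (l : List V) :
    (l : Cycle V).Chain r ↔ ∀ i (hi : i < l.length),
      r l[i] (l[(i + 1) % l.length]'(Nat.mod_lt _ (Nat.zero_lt_of_lt hi))) := by
  rcases Nat.eq_zero_or_pos l.length with h0 | h0
  · obtain rfl := List.length_eq_zero_iff.1 h0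
    simp
  obtain ⟨n, hn⟩ : ∃ n, l.length = n + 1 := ⟨l.length - 1, by omega⟩
  have : Inhabited V := ⟨l[0]⟩
  -- Seen as the image of an interval of indices, the list falls under `Cycle.chain_range_succ`,
  -- which isolates the closing edge from the last entry to the first.
  have hl : l = (List.range n.succ).map (fun i => l[i]!) := by
    apply List.ext_getElem
    · simp [hn]
    · intro i h1 h2
      simp [h1]
  have key : (l : Cycle V).Chain r ↔ ((List.range n.succ).map (fun i => l[i]!) : Cycle V).Chain r := by
    rw [← hl]
  rw [key, ← Cycle.map_coe, Cycle.chain_map, Cycle.chain_range_succ]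
  constructor
  · rintro ⟨h1, h2⟩ i hi
    rcases Nat.lt_or_ge i n with h | h
    · have := h2 i h
      have e : (i + 1) % l.length = i + 1 := Nat.mod_eq_of_lt (by omega)
      simp only [e]
      rwa [getElem!_pos l i hi, getElem!_pos l (i.succ) (by omega)] at this
    · obtain rfl : i = n := by omega
      have e : (i + 1) % l.length = 0 := by rw [hn, Nat.mod_self]
      simp only [e]
      rwa [getElem!_pos l i hi, getElem!_pos l 0 (by omega)] at h1
  · intro h
    refine ⟨?_, fun m hm => ?_⟩
    · have := h n (by omega)
      have e : (n + 1) % l.length = 0 := by rw [hn, Nat.mod_self]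
      simp only [e] at this
      rwa [getElem!_pos l n (by omega), getElem!_pos l 0 (by omega)]
    · have := h m (by omega)
      have e : (m + 1) % l.length = m + 1 := Nat.mod_eq_of_lt (by omega)
      simp only [e] at this
      rwa [getElem!_pos l m (by omega), getElem!_pos l (m.succ) (by omega)]

theorem chain_iff_next {V : Type*} [DecidableEq V] {r : V → V → Prop} {c : Cycle V}
    (hc : c.Nodup) : c.Chain r ↔ ∀ x (hx : x ∈ c), r x (c.next hc x hx) := by
  induction c using Quotient.inductionOn' with
  | h l =>
    change (l : Cycle V).Chain r ↔ ∀ x (hx : x ∈ l), r x (l.next x hx)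
    have hl : l.Nodup := hc
    rw [chain_coe_iff]
    constructor
    · intro h x hx
      obtain ⟨i, hi, rfl⟩ := List.getElem_of_mem hx
      rw [List.next_getElem _ hl]
      exact h i hi
    · intro h i hi
      have := h l[i] (List.getElem_mem hi)
      rwa [List.next_getElem _ hl] at this

/-- The clause `y ∈ c` is what `mem_reverseAlong` demands of a reversed edge. -/
theorem chain_reverse {V : Type*} [DecidableEq V] {r : V → V → Prop} {c : Cycle V}
    (hc : c.Nodup) (h : c.Chain r) : c.reverse.Chain (fun x y => r y x ∧ y ∈ c) := by
  rw [chain_iff_next (Cycle.nodup_reverse_iff.2 hc)]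
  intro x hx
  rw [Cycle.next_reverse_eq_prev']
  have hx' : x ∈ c := Cycle.mem_reverse_iff.1 hx
  have := (chain_iff_next hc).1 h _ (Cycle.prev_mem c hc x hx')
  rw [Cycle.next_prev] at this
  exact ⟨this, Cycle.prev_mem c hc x hx'⟩

theorem exists_mem_of_chain {V : Type*} [DecidableEq V] {r : V → V → Prop} {c : Cycle V}
    (hc : c.Nodup) (h : c.Chain r) {x : V} (hx : x ∈ c) : ∃ y ∈ c, r x y :=
  ⟨_, Cycle.next_mem c hc x hx, (chain_iff_next hc).1 h x hx⟩

theorem exists_mem_of_chain' {V : Type*} [DecidableEq V] {r : V → V → Prop} {c : Cycle V}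
    (hc : c.Nodup) (h : c.Chain r) {y : V} (hy : y ∈ c) : ∃ x ∈ c, r x y := by
  refine ⟨_, Cycle.prev_mem c hc y hy, ?_⟩
  have := (chain_iff_next hc).1 h _ (Cycle.prev_mem c hc y hy)
  rwa [Cycle.next_prev] at this

/-- In a relation that is the graph of a partial function, a vertex of a cycle has only one
predecessor on this cycle. -/
theorem eq_of_chain_of_mem {V : Type*} [DecidableEq V] {r : V → V → Prop}
    (hr : ∀ x y y', r x y → r x y' → y = y') {c : Cycle V}
    (hc : c.Nodup) (h : c.Chain r) {x x' y : V} (hx : x ∈ c) (hx' : x' ∈ c)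
    (hxy : r x y) (hxy' : r x' y) : x = x' := by
  have h1 : c.next hc x hx = y := hr _ _ _ ((chain_iff_next hc).1 h x hx) hxy
  have h2 : c.next hc x' hx' = y := hr _ _ _ ((chain_iff_next hc).1 h x' hx') hxy'
  rw [← Cycle.prev_next c hc x hx, ← Cycle.prev_next c hc x' hx']
  simp only [h1, h2]

theorem exists_coe_cons_eq {V : Type*} {c : Cycle V} {x : V} (hx : x ∈ c) :
    ∃ l : List V, c = ((x :: l : List V) : Cycle V) := by
  induction c using Quotient.inductionOn' with
  | h l =>
    obtain ⟨s, t, rfl⟩ := List.append_of_mem (show x ∈ l from hx)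
    refine ⟨t ++ s, ?_⟩
    exact Cycle.coe_eq_coe.2 ⟨s.length, by simp [List.rotate_append_length_eq]⟩

/-- Two cycles of a partial function that share a vertex are equal. -/
theorem cycle_eq_of_mem {V : Type*} [DecidableEq V] {r : V → V → Prop}
    (hr : ∀ x y y', r x y → r x y' → y = y') {c c' : Cycle V} (hc : c.Nodup) (hc' : c'.Nodup)
    (h : c.Chain r) (h' : c'.Chain r) {x : V} (hx : x ∈ c) (hx' : x ∈ c') : c = c' := by
  obtain ⟨l, rfl⟩ := exists_coe_cons_eq hx
  obtain ⟨l', rfl⟩ := exists_coe_cons_eq hx'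
  clear hx hx'
  wlog hle : l.length ≤ l'.length generalizing l l'
  · exact (this l' hc' h' l hc h (by omega)).symm
  rw [chain_coe_iff] at h h'
  rw [Cycle.nodup_coe_iff] at hc hc'
  -- Both lists start at `x`, and a partial function leaves no choice for the successor.
  have key : ∀ i (hi : i < (x :: l).length) (hi' : i < (x :: l').length),
      (x :: l)[i] = (x :: l')[i] := by
    intro i
    induction i with
    | zero => intros; rfl
    | succ i ih =>
      intro hi hi'
      have e := h i (by omega)
      have e' := h' i (by omega)
      simp only [Nat.mod_eq_of_lt hi] at e
      simp only [Nat.mod_eq_of_lt hi'] at e'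
      rw [← ih (by omega) (by omega)] at e'
      exact hr _ _ _ e e'
  -- If `l` were shorter, its closing edge would lead back to `x`, so `x` would reappear in `x ::
  -- l'` at position `l.length + 1`, against `Nodup`.
  have hlen : l.length = l'.length := by
    by_contra hne
    have h1 : l.length < (x :: l).length := by simp
    have h1' : l.length < (x :: l').length := by simp; omega
    have h2 : l.length + 1 < (x :: l').length := by simp; omega
    have e := h l.length h1
    have e' := h' l.length h1'
    rw [← key _ h1 h1'] at e'
    simp only [Nat.mod_eq_of_lt h2] at e'
    have := hr _ _ _ e e'
    simp only [List.length_cons, Nat.mod_self] at this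
    have h3 := (List.Nodup.getElem_inj_iff hc' (hi := by simp) (hj := h2) (i := 0)).1 this
    omega
  congr 1
  exact List.ext_getElem (by simp [hlen]) (fun i h1 h2 => key i h1 h2)

theorem chain_and {V : Type*} [DecidableEq V] {r s : V → V → Prop} {c : Cycle V}
    (hc : c.Nodup) (h : c.Chain r) (h' : c.Chain s) : c.Chain (fun x y => r x y ∧ s x y) := by
  rw [chain_iff_next hc] at *
  exact fun x hx => ⟨h x hx, h' x hx⟩

theorem chain_imp_mem {V : Type*} [DecidableEq V] {r s : V → V → Prop} {c : Cycle V}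
    (hc : c.Nodup) (h : c.Chain r) (H : ∀ x ∈ c, ∀ y ∈ c, r x y → s x y) : c.Chain s := by
  rw [chain_iff_next hc] at *
  exact fun x hx => H _ hx _ (Cycle.next_mem c hc x hx) (h x hx)

theorem exists_mem_of_ne_nil {V : Type*} {c : Cycle V} (h : c ≠ Cycle.nil) : ∃ x, x ∈ c := by
  induction c using Cycle.induction_on with
  | nil => exact absurd rfl h
  | cons a l _ => exact ⟨a, by simp⟩

theorem ne_nil_of_mem {V : Type*} {c : Cycle V} {x : V} (h : x ∈ c) : c ≠ Cycle.nil := by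
  rintro rfl
  exact Cycle.notMem_nil x h

theorem card_toFinset {V : Type*} [DecidableEq V] {c : Cycle V} (hc : c.Nodup) :
    c.toFinset.card = c.length := by
  induction c using Quotient.inductionOn' with
  | h l => exact List.toFinset_card_of_nodup hc

theorem mem_toFinset {V : Type*} [DecidableEq V] {c : Cycle V} {x : V} :
    x ∈ c.toFinset ↔ x ∈ c := by
  induction c using Quotient.inductionOn' with
  | h l => exact List.mem_toFinset

theorem nodup_map {V X : Type*} {e : V → X} (he : Function.Injective e) {c : Cycle V}
    (hc : c.Nodup) : (c.map e).Nodup := by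
  induction c using Quotient.inductionOn' with
  | h l => exact List.Nodup.map he hc

theorem length_map {V X : Type*} (e : V → X) (c : Cycle V) : (c.map e).length = c.length := by
  induction c using Quotient.inductionOn' with
  | h l => exact List.length_map e

theorem map_injective {V X : Type*} {e : V → X} (he : Function.Injective e) :
    Function.Injective (Cycle.map e) := by
  intro c c' h
  induction c using Quotient.inductionOn' with
  | h l =>
    induction c' using Quotient.inductionOn' with
    | h l' =>
      change ((l.map e : List X) : Cycle X) = ((l'.map e : List X) : Cycle X) at h
      rw [Cycle.coe_eq_coe] at h
      obtain ⟨n, hn⟩ := h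
      rw [← List.map_rotate] at hn
      exact Cycle.coe_eq_coe.2 ⟨n, List.map_injective_iff.2 he hn⟩

theorem nontrivial_of_chain_ne {V : Type*} [DecidableEq V] {r : V → V → Prop}
    (hr : ∀ x, ¬ r x x) {c : Cycle V} (hc : c.Nodup) (hn : c ≠ Cycle.nil) (h : c.Chain r) :
    c.Nontrivial := by
  obtain ⟨x, hx⟩ := exists_mem_of_ne_nil hn
  have := (chain_iff_next hc).1 h x hx
  refine ⟨x, c.next hc x hx, fun e => hr x ?_, hx, Cycle.next_mem _ _ _ _⟩
  rwa [← e] at this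

/-! ### Traces along cycles -/

theorem cycleTrace_coe {V R S : Type*} [Monoid R] (τ : R → S)
    (hτ : ∀ x y, τ (x * y) = τ (y * x)) (M : V → V → R) (l : List V) :
    cycleTrace τ hτ M (l : Cycle V) = τ (closedProd M l) := rfl

theorem cycleTrace_singleton {V R S : Type*} [Monoid R] (τ : R → S)
    (hτ : ∀ x y, τ (x * y) = τ (y * x)) (M : V → V → R) (i : V) :
    cycleTrace τ hτ M (([i] : List V) : Cycle V) = τ (M i i) := by
  rw [cycleTrace_coe]
  simp [closedProd]

theorem closedProd_map {V X R : Type*} [Monoid R] (M : X → X → R) (e : V → X) (l : List V) :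
    closedProd (fun i j => M (e i) (e j)) l = closedProd M (l.map e) := by
  unfold closedProd
  rw [← List.map_rotate, List.zipWith_map]

theorem cycleTrace_map {V X R S : Type*} [Monoid R] (τ : R → S)
    (hτ : ∀ x y, τ (x * y) = τ (y * x)) (M : X → X → R) (e : V → X) (c : Cycle V) :
    cycleTrace τ hτ (fun i j => M (e i) (e j)) c = cycleTrace τ hτ M (c.map e) := by
  induction c using Quotient.inductionOn' with
  | h l => exact congrArg τ (closedProd_map M e l)

/-- The product of the weights of the edges of a cycle. -/
def cycleWeight {V S : Type*} [CommMonoid S] (w : V → V → S) (c : Cycle V) : S :=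
  cycleTrace (fun x : S => x) (fun x y => mul_comm x y) w c

theorem cycleWeight_eq_prod {V S : Type*} [DecidableEq V] [CommMonoid S] {w : V → V → S}
    {c : Cycle V} (hc : c.Nodup) (f : V → V) (hf : c.Chain (fun i j => f i = j)) :
    cycleWeight w c = ∏ x ∈ c.toFinset, w x (f x) := by
  induction c using Quotient.inductionOn' with
  | h l =>
    change (l : Cycle V).Chain _ at hf
    change closedProd w l = ∏ x ∈ l.toFinset, w x (f x)
    rw [chain_coe_iff] at hf
    have : l.rotate 1 = l.map f := by
      apply List.ext_getElem (by simp)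
      intro i h1 h2
      rw [List.getElem_rotate, List.getElem_map, hf]
    rw [closedProd, this, List.prod_toFinset _ hc]
    congr 1
    rw [List.zipWith_map_right, List.zipWith_self]

theorem cycleWeight_eq_zero {V S : Type*} [CommMonoidWithZero S] {w : V → V → S}
    {r : V → V → Prop} (hw : ∀ x y, ¬ r x y → w x y = 0) {c : Cycle V} (hc : ¬ c.Chain r) :
    cycleWeight w c = 0 := by
  induction c using Quotient.inductionOn' with
  | h l =>
    change ¬ (l : Cycle V).Chain _ at hc
    rw [chain_coe_iff] at hc
    push Not at hc
    obtain ⟨i, hi, h⟩ := hc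
    refine List.prod_eq_zero (List.mem_iff_getElem.2 ⟨i, by simp [hi], ?_⟩)
    rw [List.getElem_zipWith, List.getElem_rotate]
    exact hw _ _ h

theorem cycleWeight_const {V S : Type*} [CommMonoid S] (s : S) (c : Cycle V) :
    cycleWeight (fun _ _ => s) c = s ^ c.length := by
  induction c using Quotient.inductionOn' with
  | h l =>
    change closedProd _ l = s ^ l.length
    rw [closedProd, List.prod_eq_pow_card _ s]
    · simp
    · intro x hx
      obtain ⟨i, hi, rfl⟩ := List.mem_iff_getElem.1 hx
      simp

/-! ### Nontrivial cycles of a map -/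

/-- The simple cycles of length at least two of the map `f`. -/
def movedCycles {V : Type*} [Fintype V] [DecidableEq V] (f : V → V) : Finset (Cycle V) :=
  simpleCycles (fun i j => i ≠ j ∧ f i = j)

theorem mem_movedCycles {V : Type*} [Fintype V] [DecidableEq V] {f : V → V} {c : Cycle V} :
    c ∈ movedCycles f ↔ c.Nodup ∧ c ≠ Cycle.nil ∧ c.Chain (fun i j => i ≠ j ∧ f i = j) :=
  mem_simpleCycles _ c

theorem moved_functional {V : Type*} (f : V → V) (x y y' : V) (h : x ≠ y ∧ f x = y)
    (h' : x ≠ y' ∧ f x = y') : y = y' := h.2.symm.trans h'.2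

theorem movedCycles_eq_of_mem {V : Type*} [Fintype V] [DecidableEq V] {f : V → V}
    {c c' : Cycle V} (hc : c ∈ movedCycles f) (hc' : c' ∈ movedCycles f) {x : V} (hx : x ∈ c)
    (hx' : x ∈ c') : c = c' := by
  rw [mem_movedCycles] at hc hc'
  exact cycle_eq_of_mem (moved_functional f) hc.1 hc'.1 hc.2.2 hc'.2.2 hx hx'

theorem movedCycles_moved {V : Type*} [Fintype V] [DecidableEq V] {f : V → V}
    {c : Cycle V} (hc : c ∈ movedCycles f) {x : V} (hx : x ∈ c) : f x ≠ x ∧ f x ∈ c := by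
  rw [mem_movedCycles] at hc
  obtain ⟨y, hy, h1, rfl⟩ := exists_mem_of_chain hc.1 hc.2.2 hx
  exact ⟨h1.symm, hy⟩

theorem movedCycles_nontrivial {V : Type*} [Fintype V] [DecidableEq V] {f : V → V}
    {c : Cycle V} (hc : c ∈ movedCycles f) : c.Nontrivial := by
  rw [mem_movedCycles] at hc
  exact nontrivial_of_chain_ne (by simp) hc.1 hc.2.1 hc.2.2

/-- On a finite set an injective map has only periodic points, and the cycle is the orbit of `x`. No
two consecutive points of it coincide, because the iterates of `σ` are injective and `σ x ≠ x`. -/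
theorem exists_movedCycles_mem {V : Type*} [Fintype V] [DecidableEq V] (σ : Equiv.Perm V)
    {x : V} (hx : σ x ≠ x) : ∃ c ∈ movedCycles σ, x ∈ c := by
  have hp : x ∈ Function.periodicPts σ :=
    Function.Injective.mem_periodicPts σ.injective x
  refine ⟨Function.periodicOrbit σ x, ?_, Function.self_mem_periodicOrbit hp⟩
  rw [mem_movedCycles]
  refine ⟨Function.nodup_periodicOrbit, ne_nil_of_mem (Function.self_mem_periodicOrbit hp), ?_⟩
  rw [Function.periodicOrbit_chain' _ hp]
  intro n
  refine ⟨?_, (Function.iterate_succ_apply' _ _ _).symm⟩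
  rw [Function.iterate_succ_apply, (σ.injective.iterate n).ne_iff]
  exact hx.symm

theorem formPerm_mem_cycleFactorsFinset {V : Type*} [Fintype V] [DecidableEq V]
    {σ : Equiv.Perm V} {c : Cycle V} (hc : c ∈ movedCycles σ) :
    c.formPerm (mem_movedCycles.1 hc).1 ∈ σ.cycleFactorsFinset := by
  have hnt := movedCycles_nontrivial hc
  rw [mem_movedCycles] at hc
  rw [Equiv.Perm.mem_cycleFactorsFinset_iff]
  refine ⟨Cycle.isCycle_formPerm _ _ hnt, fun a ha => ?_⟩
  rw [Cycle.support_formPerm _ _ hnt, mem_toFinset] at ha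
  rw [Cycle.formPerm_apply_mem_eq_next _ _ _ ha]
  exact ((chain_iff_next hc.1).1 hc.2.2 a ha).2.symm

/-- The moved cycles correspond bijectively to the cycle factors of `σ` through `Cycle.formPerm`, so
the signature can be read off the cycle type. -/
theorem sign_eq_prod_movedCycles {V : Type*} [Fintype V] [DecidableEq V] (σ : Equiv.Perm V) :
    Equiv.Perm.sign σ = ∏ c ∈ movedCycles σ, -(-1 : ℤˣ) ^ c.length := by
  have : Equiv.Perm.sign σ = ∏ g ∈ σ.cycleFactorsFinset, -(-1 : ℤˣ) ^ g.support.card := by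
    rw [Equiv.Perm.sign_of_cycleType', Equiv.Perm.cycleType_def, Multiset.map_map]
    rfl
  rw [this]
  symm
  refine Finset.prod_bij (fun c hc => c.formPerm (mem_movedCycles.1 hc).1)
    (fun c hc => formPerm_mem_cycleFactorsFinset hc) ?_ ?_ ?_
  · intro c hc c' hc' h
    obtain ⟨x, hx⟩ := exists_mem_of_ne_nil (mem_movedCycles.1 hc).2.1
    refine movedCycles_eq_of_mem hc hc' hx ?_
    have h' := congrArg Equiv.Perm.support h
    rw [Cycle.support_formPerm _ _ (movedCycles_nontrivial hc),
      Cycle.support_formPerm _ _ (movedCycles_nontrivial hc')] at h'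
    rwa [← mem_toFinset, ← h', mem_toFinset]
  · intro g hg
    have hg' := Equiv.Perm.mem_cycleFactorsFinset_iff.1 hg
    obtain ⟨x, hx⟩ := hg'.1.nonempty_support
    have hσx : σ x ≠ x := by
      rw [← hg'.2 x hx]
      exact Equiv.Perm.mem_support.1 hx
    obtain ⟨c, hc, hxc⟩ := exists_movedCycles_mem σ hσx
    refine ⟨c, hc, ?_⟩
    have h1 := formPerm_mem_cycleFactorsFinset hc
    -- Two cycle factors of `σ` that both move `x` equal `σ.cycleOf x`.
    rw [Equiv.Perm.cycle_is_cycleOf hx hg]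
    refine Equiv.Perm.cycle_is_cycleOf ?_ h1
    rwa [Cycle.support_formPerm _ _ (movedCycles_nontrivial hc), mem_toFinset]
  · intro c hc
    rw [Cycle.support_formPerm _ _ (movedCycles_nontrivial hc),
      card_toFinset (mem_movedCycles.1 hc).1]

theorem prod_simpleCycles_perm {V S : Type*} [Fintype V] [DecidableEq V] [CommMonoid S]
    (σ : Equiv.Perm V) (g : Cycle V → S) :
    ∏ c ∈ simpleCycles (fun i j => σ i = j), g c =
      (∏ c ∈ movedCycles σ, g c) *
        ∏ i ∈ Finset.univ.filter (fun i => σ i = i), g (([i] : List V) : Cycle V) := by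
  classical
  have hinj : Function.Injective (fun i : V => (([i] : List V) : Cycle V)) := by
    intro i j h
    simpa using Cycle.coe_eq_coe.1 h
  have hmem : ∀ c : Cycle V, c ∈ simpleCycles (fun i j => σ i = j) ↔
      c ∈ movedCycles σ ∪ (Finset.univ.filter (fun i => σ i = i)).image
        (fun i : V => (([i] : List V) : Cycle V)) := by
    intro c
    rw [Finset.mem_union, mem_simpleCycles, mem_movedCycles, Finset.mem_image]
    constructor
    · rintro ⟨h1, h2, h3⟩
      obtain ⟨x, hx⟩ := exists_mem_of_ne_nil h2
      by_cases hσ : σ x = x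
      · right
        refine ⟨x, by simpa using hσ, ?_⟩
        refine cycle_eq_of_mem (r := fun i j => σ i = j) (x := x) ?_ (by simp) h1 ?_ h3 (by simp) hx
        · rintro a b b' rfl rfl; rfl
        · rw [Cycle.chain_singleton]; exact hσ
      · left
        obtain ⟨c', hc', hx'⟩ := exists_movedCycles_mem σ hσ
        rw [mem_movedCycles] at hc'
        have : c = c' := by
          refine cycle_eq_of_mem (r := fun i j => σ i = j) (x := x) ?_ h1 hc'.1 h3
            (hc'.2.2.imp fun _ _ h => h.2) hx hx'
          rintro a b b' rfl rfl; rfl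
        rwa [this]
    · rintro (⟨h1, h2, h3⟩ | ⟨i, hi, rfl⟩)
      · exact ⟨h1, h2, h3.imp fun _ _ h => h.2⟩
      · refine ⟨by simp, by simp, ?_⟩
        rw [Cycle.chain_singleton]
        simpa using hi
  rw [Finset.ext hmem, Finset.prod_union, Finset.prod_image hinj.injOn]
  rw [Finset.disjoint_left]
  intro c hc h
  obtain ⟨i, hi, rfl⟩ := Finset.mem_image.1 h
  exact (movedCycles_moved hc (x := i) (by simp)).1 (by simpa using hi)

/-- Fixed points have sign `+1`, so the signature can be distributed over the moved cycles alone. -/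
theorem tauDet_eq_sum_movedCycles {ι R S : Type*} [Fintype ι] [DecidableEq ι] [Monoid R]
    [CommRing S] (τ : R → S) (hτ : ∀ x y, τ (x * y) = τ (y * x)) (M : Matrix ι ι R) :
    tauDet τ hτ M = ∑ σ : Equiv.Perm ι,
      (∏ c ∈ movedCycles σ, (-(-1) ^ c.length * cycleTrace τ hτ M c)) *
        ∏ i ∈ Finset.univ.filter (fun i => σ i = i), τ (M i i) := by
  refine Finset.sum_congr rfl fun σ _ => ?_
  rw [prod_simpleCycles_perm, ← mul_assoc, Finset.prod_mul_distrib, sign_eq_prod_movedCycles,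
    Finset.prod_congr rfl fun i _ => cycleTrace_singleton τ hτ M i]
  push_cast
  rfl

/-! ### Restriction of a map to some of its cycles -/

/-- Take `f` on the cycles of `C` and the identity elsewhere. Each vertex of a cycle has a
predecessor on it, so this map is surjective, hence bijective by finiteness. -/
theorem exists_perm_of_subset_movedCycles {V : Type*} [Fintype V] [DecidableEq V] {f : V → V}
    {C : Finset (Cycle V)} (hC : C ⊆ movedCycles f) :
    ∃ σ : Equiv.Perm V, (∀ x, σ x ≠ x → f x = σ x) ∧ movedCycles σ = C := by
  classical
  let g : V → V := fun x => if ∃ c ∈ C, x ∈ c then f x else x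
  have hg1 : ∀ x, (∃ c ∈ C, x ∈ c) → g x = f x := fun x h => if_pos h
  have hg2 : ∀ x, (¬ ∃ c ∈ C, x ∈ c) → g x = x := fun x h => if_neg h
  have hsurj : Function.Surjective g := by
    intro y
    by_cases hy : ∃ c ∈ C, y ∈ c
    · obtain ⟨c, hc, hyc⟩ := hy
      have hc' := mem_movedCycles.1 (hC hc)
      obtain ⟨x, hx, h⟩ := exists_mem_of_chain' hc'.1 hc'.2.2 hyc
      exact ⟨x, (hg1 x ⟨c, hc, hx⟩).trans h.2⟩
    · exact ⟨y, hg2 y hy⟩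
  have hbij : Function.Bijective g := ⟨Finite.injective_iff_surjective.2 hsurj, hsurj⟩
  have hsub : C ⊆ movedCycles g := by
    intro c hc
    have hc' := mem_movedCycles.1 (hC hc)
    refine mem_movedCycles.2 ⟨hc'.1, hc'.2.1, chain_imp_mem hc'.1 hc'.2.2 ?_⟩
    intro x hx y _ h
    exact ⟨h.1, (hg1 x ⟨c, hc, hx⟩).trans h.2⟩
  refine ⟨Equiv.ofBijective g hbij, ?_, ?_⟩
  · intro x hx
    by_cases h : ∃ c ∈ C, x ∈ c
    · exact (hg1 x h).symm
    · exact absurd (hg2 x h) hx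
  · change movedCycles g = C
    refine Finset.Subset.antisymm ?_ hsub
    intro c hc
    obtain ⟨x, hx⟩ := exists_mem_of_ne_nil (mem_movedCycles.1 hc).2.1
    have hne := (movedCycles_moved hc hx).1
    by_cases h : ∃ c ∈ C, x ∈ c
    · obtain ⟨c', hc', hx'⟩ := h
      rwa [movedCycles_eq_of_mem hc (hsub hc') hx hx']
    · exact absurd (hg2 x h) hne

theorem prod_movedCycles_toFinset {V S : Type*} [Fintype V] [DecidableEq V] [CommMonoid S]
    {f : V → V} {C : Finset (Cycle V)} (hC : C ⊆ movedCycles f) (w : V → S)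
    (p : V → Prop) [DecidablePred p] (hp : ∀ x, p x ↔ ∃ c ∈ C, x ∈ c) :
    ∏ c ∈ C, ∏ x ∈ c.toFinset, w x = ∏ x ∈ Finset.univ.filter p, w x := by
  rw [← Finset.prod_biUnion]
  · refine Finset.prod_congr ?_ fun _ _ => rfl
    ext x
    simp [hp, mem_toFinset]
  · intro c hc c' hc' hne
    rw [Function.onFun, Finset.disjoint_left]
    intro x hx hx'
    rw [mem_toFinset] at hx hx'
    exact hne (movedCycles_eq_of_mem (hC hc) (hC hc') hx hx')

theorem moved_iff_exists_mem {V : Type*} [Fintype V] [DecidableEq V] (σ : Equiv.Perm V) (x : V) :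
    σ x ≠ x ↔ ∃ c ∈ movedCycles σ, x ∈ c :=
  ⟨fun h => exists_movedCycles_mem σ h, fun ⟨_, hc, hx⟩ => (movedCycles_moved hc hx).1⟩

open Classical in
-- A permutation that agrees with `f` wherever it moves a point is determined by its cycles, and
-- these may form any subset of the cycles of `f`. `Finset.prod_add` expands the right-hand product
-- over exactly these subsets: `m c` for the cycles kept, the product of `w` for those whose points
-- are all fixed.
theorem sum_perm_compatible {V S : Type*} [Fintype V] [DecidableEq V] [CommRing S] (f : V → V)
    (m : Cycle V → S) (w : V → S) :
    ∑ σ ∈ (Finset.univ : Finset (Equiv.Perm V)).filter (fun σ => ∀ x, σ x ≠ x → f x = σ x),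
      (∏ c ∈ movedCycles σ, m c) * ∏ x ∈ Finset.univ.filter (fun x => σ x = x), w x =
    (∏ c ∈ movedCycles f, (m c + ∏ x ∈ c.toFinset, w x)) *
      ∏ x ∈ Finset.univ.filter (fun x => ∀ c ∈ movedCycles f, x ∉ c), w x := by
  rw [Finset.prod_add, Finset.sum_mul]
  refine Finset.sum_bij (fun σ _ => movedCycles σ) ?_ ?_ ?_ ?_
  · intro σ hσ
    rw [Finset.mem_filter] at hσ
    rw [Finset.mem_powerset]
    intro c hc
    rw [mem_movedCycles] at hc ⊢
    refine ⟨hc.1, hc.2.1, hc.2.2.imp ?_⟩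
    rintro x y ⟨h1, rfl⟩
    exact ⟨h1, hσ.2 x h1.symm⟩
  · intro σ hσ σ' hσ' h
    rw [Finset.mem_filter] at hσ hσ'
    ext x
    have hiff : σ x ≠ x ↔ σ' x ≠ x := by
      rw [moved_iff_exists_mem, moved_iff_exists_mem, h]
    by_cases hx : σ x = x
    · rw [hx, not_not.1 (hiff.not.1 (not_not.2 hx))]
    · rw [← hσ.2 x hx, hσ'.2 x (hiff.1 hx)]
  · intro C hC
    obtain ⟨σ, h1, h2⟩ := exists_perm_of_subset_movedCycles (Finset.mem_powerset.1 hC)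
    exact ⟨σ, by simpa using h1, h2⟩
  · intro σ hσ
    rw [Finset.mem_filter] at hσ
    have hsub : movedCycles σ ⊆ movedCycles f := by
      intro c hc
      rw [mem_movedCycles] at hc ⊢
      refine ⟨hc.1, hc.2.1, hc.2.2.imp ?_⟩
      rintro x y ⟨h1, rfl⟩
      exact ⟨h1, hσ.2 x h1.symm⟩
    rw [mul_assoc]
    congr 1
    -- The fixed points of `σ` are the points of the cycles of `f` not kept by `σ`, together with
    -- the points on no cycle of `f`.
    rw [prod_movedCycles_toFinset (f := f) Finset.sdiff_subset w
      (fun x => ∃ c ∈ movedCycles f \ movedCycles σ, x ∈ c) (fun _ => Iff.rfl),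
      ← Finset.prod_union]
    · refine Finset.prod_congr ?_ fun _ _ => rfl
      ext x
      have : ¬ σ x = x ↔ _ := moved_iff_exists_mem σ x
      simp only [Finset.mem_union, Finset.mem_filter, Finset.mem_univ, true_and,
        Finset.mem_sdiff]
      rw [← not_iff_not, this]
      push Not
      constructor
      · rintro ⟨c, hc, hx⟩
        refine ⟨fun c' hc' hx' => hc'.2 ?_, c, hsub hc, hx⟩
        rwa [movedCycles_eq_of_mem hc'.1 (hsub hc) hx' hx]
      · rintro ⟨h1, c, hc, hx⟩
        refine ⟨c, ?_, hx⟩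
        by_contra hn
        exact h1 c ⟨hc, hn⟩ hx
    · rw [Finset.disjoint_left]
      intro x hx hx'
      simp only [Finset.mem_filter, Finset.mem_univ, true_and, Finset.mem_sdiff] at hx hx'
      obtain ⟨c, hc, hxc⟩ := hx
      exact hx' c hc.1 hxc

/-! ### Permutations of a subset -/

theorem movedCycles_map {ι X : Type*} [Fintype ι] [DecidableEq ι] [Fintype X] [DecidableEq X]
    (e : ι ↪ X) (σ : Equiv.Perm ι) (ρ : Equiv.Perm X) (h1 : ∀ i, ρ (e i) = e (σ i))
    (h2 : ∀ x, x ∉ Set.range e → ρ x = x) :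
    movedCycles ρ = (movedCycles σ).map ⟨Cycle.map e, map_injective e.injective⟩ := by
  have hsub : ∀ c ∈ movedCycles σ, c.map e ∈ movedCycles ρ := by
    intro c hc
    rw [mem_movedCycles] at hc ⊢
    refine ⟨nodup_map e.injective hc.1, by simpa using hc.2.1, ?_⟩
    rw [Cycle.chain_map]
    refine hc.2.2.imp fun x y h => ⟨e.injective.ne h.1, ?_⟩
    rw [h1, h.2]
  ext c
  rw [Finset.mem_map]
  constructor
  · intro hc
    obtain ⟨x, hx⟩ := exists_mem_of_ne_nil (mem_movedCycles.1 hc).2.1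
    have hne := (movedCycles_moved hc hx).1
    by_cases hr : x ∈ Set.range e
    · obtain ⟨i, rfl⟩ := hr
      rw [h1, e.injective.ne_iff] at hne
      obtain ⟨c', hc', hi⟩ := exists_movedCycles_mem σ hne
      exact ⟨c', hc', movedCycles_eq_of_mem (hsub _ hc') hc (Cycle.mem_map.2 ⟨i, hi, rfl⟩) hx⟩
    · exact absurd (h2 x hr) hne
  · rintro ⟨c', hc', rfl⟩
    exact hsub c' hc'

/-- This carries the expansion of a principal submatrix to the whole vertex set: permutations of the
index set become permutations that are the identity outside `W`. -/
theorem sum_perm_embedding {ι X S : Type*} [Fintype ι] [DecidableEq ι] [Fintype X]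
    [DecidableEq X] [CommRing S] (e : ι ↪ X) (W : Finset X) (hW : ∀ x, x ∈ W ↔ x ∈ Set.range e)
    (m : Cycle X → S) (D : X → S) :
    ∑ σ : Equiv.Perm ι, (∏ c ∈ movedCycles σ, m (c.map e)) *
      ∏ i ∈ Finset.univ.filter (fun i => σ i = i), D (e i) =
    ∑ ρ ∈ (Finset.univ : Finset (Equiv.Perm X)).filter (fun ρ => ∀ x, x ∉ W → ρ x = x),
      (∏ c ∈ movedCycles ρ, m c) * ∏ x ∈ W.filter (fun x => ρ x = x), D x := by
  refine Finset.sum_bij (fun σ _ => σ.viaFintypeEmbedding e) ?_ ?_ ?_ ?_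
  · intro σ _
    rw [Finset.mem_filter]
    refine ⟨Finset.mem_univ _, fun x hx => ?_⟩
    rw [hW] at hx
    exact σ.viaFintypeEmbedding_apply_notMem_range e hx
  · intro σ _ σ' _ h
    ext i
    apply e.injective
    have := Equiv.Perm.ext_iff.1 h (e i)
    rwa [Equiv.Perm.viaFintypeEmbedding_apply_image,
      Equiv.Perm.viaFintypeEmbedding_apply_image] at this
  · intro ρ hρ
    rw [Finset.mem_filter] at hρ
    -- A value outside the image of `e` would be fixed by `ρ`; injectivity would then make it equal
    -- to `e i`, which lies in the image.
    have hmem : ∀ i, ∃ j, e j = ρ (e i) := by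
      intro i
      by_contra hn
      have h1 : ρ (ρ (e i)) = ρ (e i) := hρ.2 _ (fun h => hn ((hW _).1 h))
      exact hn ⟨i, (ρ.injective h1).symm⟩
    choose g hg using hmem
    have hinj : Function.Injective g := by
      intro i j h
      apply e.injective
      apply ρ.injective
      rw [← hg, ← hg, h]
    refine ⟨Equiv.ofBijective g (Finite.injective_iff_bijective.1 hinj), Finset.mem_univ _, ?_⟩
    ext x
    by_cases hx : x ∈ Set.range e
    · obtain ⟨i, rfl⟩ := hx
      rw [Equiv.Perm.viaFintypeEmbedding_apply_image]
      exact hg i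
    · rw [Equiv.Perm.viaFintypeEmbedding_apply_notMem_range _ _ hx, hρ.2 x (by rwa [hW])]
  · intro σ _
    have h1 : ∀ i, σ.viaFintypeEmbedding e (e i) = e (σ i) :=
      fun i => σ.viaFintypeEmbedding_apply_image e i
    rw [movedCycles_map e σ _ h1 fun x hx => σ.viaFintypeEmbedding_apply_notMem_range e hx,
      Finset.prod_map]
    congr 1
    rw [← Finset.prod_map _ e D]
    refine Finset.prod_congr ?_ fun _ _ => rfl
    ext x
    simp only [Finset.mem_map, Finset.mem_filter, Finset.mem_univ, true_and, hW, Set.mem_range]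
    constructor
    · rintro ⟨i, hi, rfl⟩
      exact ⟨⟨i, rfl⟩, by rw [h1, hi]⟩
    · rintro ⟨⟨i, rfl⟩, hi⟩
      rw [h1, e.injective.eq_iff] at hi
      exact ⟨i, hi, rfl⟩

/-! ### Cycle-rooted spanning forests -/

theorem mem_forests {V : Type*} [DecidableEq V] {E : Finset (V × V)} {W : Finset V}
    {F : Finset (V × V)} :
    F ∈ forests E W ↔ F ⊆ E ∧ (∀ e ∈ F, e.1 ∈ W) ∧ ∀ i ∈ W, ∃! e, e ∈ F ∧ e.1 = i := by
  simp [forests]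

theorem forests_functional {V : Type*} [DecidableEq V] {E : Finset (V × V)} {W : Finset V}
    {F : Finset (V × V)} (hF : F ∈ forests E W) (x y y' : V) (h : (x, y) ∈ F)
    (h' : (x, y') ∈ F) : y = y' := by
  rw [mem_forests] at hF
  have := (hF.2.2 x (hF.2.1 _ h)).unique ⟨h, rfl⟩ ⟨h', rfl⟩
  exact congrArg Prod.snd this

theorem mem_cyclesOf {V : Type*} [Fintype V] [DecidableEq V] {F : Finset (V × V)} {c : Cycle V} :
    c ∈ cyclesOf F ↔ c.Nodup ∧ c ≠ Cycle.nil ∧ c.Chain (fun i j => (i, j) ∈ F) :=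
  mem_simpleCycles _ c

theorem cyclesOf_eq_of_mem {V : Type*} [Fintype V] [DecidableEq V] {E : Finset (V × V)}
    {W : Finset V} {F : Finset (V × V)} (hF : F ∈ forests E W) {c c' : Cycle V}
    (hc : c ∈ cyclesOf F) (hc' : c' ∈ cyclesOf F) {x : V} (hx : x ∈ c) (hx' : x ∈ c') :
    c = c' := by
  rw [mem_cyclesOf] at hc hc'
  exact cycle_eq_of_mem (forests_functional hF) hc.1 hc'.1 hc.2.2 hc'.2.2 hx hx'

/-- The edges of `F` that lie on no cycle of `F`. -/
def branches {V : Type*} [Fintype V] [DecidableEq V] (F : Finset (V × V)) :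
    Finset (V × V) := by
  classical
  exact F.filter (fun e => ∀ c ∈ cyclesOf F, e.1 ∉ c)

theorem mem_branches {V : Type*} [Fintype V] [DecidableEq V] {F : Finset (V × V)} {e : V × V} :
    e ∈ branches F ↔ e ∈ F ∧ ∀ c ∈ cyclesOf F, e.1 ∉ c := by
  simp [branches]

/-- The set of the edges `(x, f x)` for `x` in `W`. -/
def graphOn {V : Type*} [DecidableEq V] (W : Finset V) (f : V → V) : Finset (V × V) :=
  W.image (fun x => (x, f x))

theorem mem_graphOn {V : Type*} [DecidableEq V] {W : Finset V} {f : V → V} {x y : V} :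
    (x, y) ∈ graphOn W f ↔ x ∈ W ∧ f x = y := by
  simp only [graphOn, Finset.mem_image, Prod.mk.injEq]
  constructor
  · rintro ⟨a, h, rfl, rfl⟩
    exact ⟨h, rfl⟩
  · rintro ⟨h, rfl⟩
    exact ⟨x, h, rfl, rfl⟩

theorem prod_graphOn {V S : Type*} [DecidableEq V] [CommMonoid S] (W : Finset V) (f : V → V)
    (g : V × V → S) : ∏ e ∈ graphOn W f, g e = ∏ x ∈ W, g (x, f x) := by
  refine Finset.prod_image ?_
  intro x _ y _ h
  exact congrArg Prod.fst h

/-- The map is set to the identity outside `W`, where the forest has no edge; the condition `i ≠ j`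
in `movedCycles` discards these artificial fixed points. -/
theorem cyclesOf_graphOn {V : Type*} [Fintype V] [DecidableEq V] {W : Finset V} {f : V → V}
    (h1 : ∀ x, x ∉ W → f x = x) (h2 : ∀ x ∈ W, f x ≠ x) :
    cyclesOf (graphOn W f) = movedCycles f := by
  unfold cyclesOf movedCycles
  congr 1
  ext x y
  rw [mem_graphOn]
  constructor
  · rintro ⟨h, rfl⟩
    exact ⟨(h2 x h).symm, rfl⟩
  · rintro ⟨h, rfl⟩
    refine ⟨?_, rfl⟩
    by_contra hn
    exact h (h1 x hn).symm

theorem graphOn_mem_forests {V : Type*} [DecidableEq V] {E : Finset (V × V)} {W : Finset V}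
    {f : V → V} (h : ∀ x ∈ W, (x, f x) ∈ E) : graphOn W f ∈ forests E W := by
  rw [mem_forests]
  refine ⟨?_, ?_, ?_⟩
  · rintro ⟨x, y⟩ hxy
    rw [mem_graphOn] at hxy
    rw [← hxy.2]
    exact h x hxy.1
  · rintro ⟨x, y⟩ hxy
    exact (mem_graphOn.1 hxy).1
  · intro x hx
    refine ⟨(x, f x), ⟨mem_graphOn.2 ⟨hx, rfl⟩, rfl⟩, ?_⟩
    rintro ⟨x', y⟩ ⟨hxy, rfl⟩
    rw [(mem_graphOn.1 hxy).2]

theorem exists_eq_graphOn {V : Type*} [DecidableEq V] {E : Finset (V × V)} {W : Finset V}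
    {F : Finset (V × V)} (hF : F ∈ forests E W) :
    ∃ f : V → V, (∀ x, x ∉ W → f x = x) ∧ (∀ x ∈ W, (x, f x) ∈ E) ∧ graphOn W f = F := by
  have hF' := mem_forests.1 hF
  have : ∀ x, ∃ y, (x ∉ W → y = x) ∧ (x ∈ W → (x, y) ∈ F) := by
    intro x
    by_cases hx : x ∈ W
    · obtain ⟨⟨x', y⟩, ⟨h, rfl⟩, _⟩ := hF'.2.2 x hx
      exact ⟨y, fun hn => absurd hx hn, fun _ => h⟩
    · exact ⟨x, fun _ => rfl, fun h => absurd h hx⟩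
  choose f hf1 hf2 using this
  refine ⟨f, hf1, fun x hx => hF'.1 (hf2 x hx), ?_⟩
  ext ⟨x, y⟩
  rw [mem_graphOn]
  constructor
  · rintro ⟨hx, rfl⟩
    exact hf2 x hx
  · intro h
    have hx := hF'.2.1 _ h
    exact ⟨hx, forests_functional hF x _ _ (hf2 x hx) h⟩

/-- A forest is a choice of successor on `W`; the convention `f x = x` elsewhere makes the map
unique. -/
theorem sum_forests_eq_sum_graphOn {V S : Type*} [Fintype V] [DecidableEq V] [AddCommMonoid S]
    (E : Finset (V × V)) (W : Finset V) (T : Finset (V × V) → S) :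
    ∑ F ∈ forests E W, T F = ∑ f ∈ (Finset.univ : Finset (V → V)).filter
      (fun f => (∀ x, x ∉ W → f x = x) ∧ ∀ x ∈ W, (x, f x) ∈ E), T (graphOn W f) := by
  symm
  refine Finset.sum_bij (fun f _ => graphOn W f) ?_ ?_ ?_ (fun _ _ => rfl)
  · intro f hf
    exact graphOn_mem_forests (Finset.mem_filter.1 hf).2.2
  · intro f hf g hg h
    rw [Finset.mem_filter] at hf hg
    funext x
    by_cases hx : x ∈ W
    · have : (x, f x) ∈ graphOn W g := by
        rw [← h, mem_graphOn]
        exact ⟨hx, rfl⟩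
      exact (mem_graphOn.1 this).2.symm
    · rw [hf.2.1 x hx, hg.2.1 x hx]
  · intro F hF
    obtain ⟨f, h1, h2, h3⟩ := exists_eq_graphOn hF
    exact ⟨f, by simpa using ⟨h1, h2⟩, h3⟩

theorem prod_branches_graphOn {V S : Type*} [Fintype V] [DecidableEq V] [CommMonoid S]
    {W : Finset V} {f : V → V} (h1 : ∀ x, x ∉ W → f x = x) (h2 : ∀ x ∈ W, f x ≠ x)
    (g : V → V → S) (p : V → Prop) [DecidablePred p] (hp : ∀ x, p x ↔ ∀ c ∈ movedCycles f, x ∉ c) :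
    ∏ e ∈ branches (graphOn W f), g e.1 e.2 = ∏ x ∈ W.filter p, g x (f x) := by
  have : branches (graphOn W f) = graphOn (W.filter p) f := by
    ext ⟨x, y⟩
    rw [mem_branches, mem_graphOn, mem_graphOn, Finset.mem_filter, hp, cyclesOf_graphOn h1 h2]
    tauto
  rw [this, prod_graphOn]

/-- The product over the edges of a forest, split into cycles and branches. -/
theorem prod_forest_eq {V S : Type*} [Fintype V] [DecidableEq V] [CommMonoid S]
    {E : Finset (V × V)} (hE : ∀ e ∈ E, e.1 ≠ e.2) {W : Finset V} {F : Finset (V × V)}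
    (hF : F ∈ forests E W) (g : V → V → S) :
    ∏ e ∈ F, g e.1 e.2 =
      (∏ c ∈ cyclesOf F, cycleWeight g c) * ∏ e ∈ branches F, g e.1 e.2 := by
  classical
  obtain ⟨f, h1, h2, rfl⟩ := exists_eq_graphOn hF
  have h2' : ∀ x ∈ W, f x ≠ x := fun x hx => (hE _ (h2 x hx)).symm
  rw [prod_graphOn, cyclesOf_graphOn h1 h2',
    prod_branches_graphOn h1 h2' g (fun x => ¬ ∃ c ∈ movedCycles f, x ∈ c) (by simp),
    ← Finset.prod_filter_mul_prod_filter_not W (fun x => ∃ c ∈ movedCycles f, x ∈ c)]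
  congr 1
  rw [Finset.prod_congr rfl (fun c hc => cycleWeight_eq_prod (mem_movedCycles.1 hc).1 f
      ((mem_movedCycles.1 hc).2.2.imp fun _ _ h => h.2)),
    prod_movedCycles_toFinset (f := f) (Finset.Subset.refl _) (fun x => g x (f x))
      (fun x => ∃ c ∈ movedCycles f, x ∈ c) (fun _ => Iff.rfl)]
  refine Finset.prod_congr ?_ fun _ _ => rfl
  ext x
  simp only [Finset.mem_filter, Finset.mem_univ, true_and, and_iff_right_iff_imp]
  rintro ⟨c, hc, hx⟩
  by_contra hn
  exact (movedCycles_moved hc hx).1 (h1 x hn)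

theorem card_forest {V : Type*} [DecidableEq V] {E : Finset (V × V)} {W : Finset V}
    {F : Finset (V × V)} (hF : F ∈ forests E W) : F.card = W.card := by
  obtain ⟨f, h1, h2, rfl⟩ := exists_eq_graphOn hF
  exact Finset.card_image_of_injective _ fun x y h => congrArg Prod.fst h

open Classical in
-- Double counting of pairs `(ρ, f)`, where `f` extends the moved part of `ρ` by a choice of target
-- at each fixed point of `W`. Summing over `f` first recovers the row sums; summing over `ρ` first
-- is `sum_perm_compatible`.
theorem sum_perm_eq_sum_forests {V S : Type*} [Fintype V] [DecidableEq V] [CommRing S]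
    {E : Finset (V × V)} (hE : ∀ e ∈ E, e.1 ≠ e.2) (W : Finset V) (m : Cycle V → S)
    (w : V → V → S) (hw : ∀ x y, (x, y) ∉ E → w x y = 0)
    (hm : ∀ c : Cycle V, ¬ c.Chain (fun x y => (x, y) ∈ E) → m c = 0) :
    ∑ ρ ∈ (Finset.univ : Finset (Equiv.Perm V)).filter (fun ρ => ∀ x, x ∉ W → ρ x = x),
      (∏ c ∈ movedCycles ρ, m c) * ∏ x ∈ W.filter (fun x => ρ x = x), ∑ y, w x y =
    ∑ F ∈ forests E W, (∏ c ∈ cyclesOf F, (m c + cycleWeight w c)) *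
      ∏ e ∈ branches F, w e.1 e.2 := by
  have step1 : ∀ ρ ∈ (Finset.univ : Finset (Equiv.Perm V)).filter
      (fun ρ => ∀ x, x ∉ W → ρ x = x),
      (∏ c ∈ movedCycles ρ, m c) * ∏ x ∈ W.filter (fun x => ρ x = x), ∑ y, w x y =
      ∑ f ∈ (Finset.univ : Finset (V → V)).filter
        (fun f => (∀ x, x ∉ W → f x = x) ∧ ∀ x, ρ x ≠ x → f x = ρ x),
        (∏ c ∈ movedCycles ρ, m c) *
          ∏ x ∈ Finset.univ.filter (fun x => ρ x = x), (if x ∈ W then w x (f x) else 1) := by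
    intro ρ hρ
    rw [Finset.mem_filter] at hρ
    rw [← Finset.mul_sum]
    congr 1
    -- The missing vertices receive a one-element set of targets and the factor 1, so that the
    -- product of sums runs over all vertices and its expansion is indexed by full maps `f`.
    have e1 : ∏ x ∈ W.filter (fun x => ρ x = x), ∑ y, w x y =
        ∏ x, ∑ y ∈ (if x ∈ W then (if ρ x = x then Finset.univ else {ρ x}) else {x} : Finset V),
          (if ρ x = x then (if x ∈ W then w x y else 1) else 1) := by
      rw [← Finset.filter_univ_mem W, Finset.filter_filter, Finset.prod_filter]
      refine Finset.prod_congr rfl fun x _ => ?_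
      by_cases hx : x ∈ W <;> by_cases hx' : ρ x = x <;> simp [hx, hx']
    rw [e1, Finset.prod_univ_sum]
    refine Finset.sum_congr ?_ fun f _ => ?_
    · ext f
      simp only [Fintype.mem_piFinset, Finset.mem_filter, Finset.mem_univ, true_and]
      constructor
      · intro h
        refine ⟨fun x hx => by simpa [hx] using h x, fun x hx => ?_⟩
        have hxW : x ∈ W := by
          by_contra hn
          exact hx (hρ.2 x hn)
        simpa [hx, hxW] using h x
      · rintro ⟨h1, h2⟩ x
        by_cases hxW : x ∈ W
        · by_cases hx : ρ x = x
          · simp [hxW, hx]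
          · simpa [hxW, hx] using h2 x hx
        · simpa [hxW] using h1 x hxW
    · rw [Finset.prod_filter]
  rw [Finset.sum_congr rfl step1]
  -- After the exchange, the condition that `ρ` fix the complement of `W` is automatic: if `ρ` moved
  -- `x ∉ W`, then `ρ x = f x = x`.
  rw [Finset.sum_comm' (t' := (Finset.univ : Finset (V → V)).filter (fun f => ∀ x, x ∉ W → f x = x))
    (s' := fun f => (Finset.univ : Finset (Equiv.Perm V)).filter
      (fun σ => ∀ x, σ x ≠ x → f x = σ x))]
  · rw [Finset.sum_congr rfl fun f _ => sum_perm_compatible f m _, sum_forests_eq_sum_graphOn]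
    have hsub : (Finset.univ : Finset (V → V)).filter
        (fun f => (∀ x, x ∉ W → f x = x) ∧ ∀ x ∈ W, (x, f x) ∈ E) ⊆
        (Finset.univ : Finset (V → V)).filter (fun f => ∀ x, x ∉ W → f x = x) := by
      intro f hf
      simp only [Finset.mem_filter, Finset.mem_univ, true_and] at hf ⊢
      exact hf.1
    have hcyc : ∀ f : V → V, (∀ x, x ∉ W → f x = x) → ∀ c ∈ movedCycles f, ∀ x ∈ c, x ∈ W := by
      intro f hf c hc x hx
      by_contra hn
      exact (movedCycles_moved hc hx).1 (hf x hn)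
    -- Maps that use a non-edge contribute 0: if the non-edge lies on a cycle, both terms of that
    -- cycle's factor vanish, and otherwise a branch factor does.
    rw [← Finset.sum_subset hsub]
    · refine Finset.sum_congr rfl fun f hf => ?_
      simp only [Finset.mem_filter, Finset.mem_univ, true_and] at hf
      have h2 : ∀ x ∈ W, f x ≠ x := fun x hx => (hE _ (hf.2 x hx)).symm
      rw [cyclesOf_graphOn hf.1 h2, prod_branches_graphOn hf.1 h2 w _ (fun _ => Iff.rfl)]
      congr 1
      · refine Finset.prod_congr rfl fun c hc => ?_
        have hc' := mem_movedCycles.1 hc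
        rw [cycleWeight_eq_prod hc'.1 f (hc'.2.2.imp fun _ _ h => h.2)]
        congr 1
        refine Finset.prod_congr rfl fun x hx => if_pos ?_
        exact hcyc f hf.1 c hc x (mem_toFinset.1 hx)
      · rw [← Finset.prod_filter, Finset.filter_filter]
        refine Finset.prod_congr ?_ fun _ _ => rfl
        ext x
        simp [and_comm]
    · intro f hf hf'
      simp only [Finset.mem_filter, Finset.mem_univ, true_and] at hf hf'
      have : ∃ x ∈ W, (x, f x) ∉ E := by
        by_contra hn
        push Not at hn
        exact hf' ⟨hf, hn⟩
      obtain ⟨x, hx, hxE⟩ := this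
      by_cases hc : ∃ c ∈ movedCycles f, x ∈ c
      · obtain ⟨c, hc, hxc⟩ := hc
        refine mul_eq_zero_of_left (Finset.prod_eq_zero hc ?_) _
        rw [Finset.prod_eq_zero (mem_toFinset.2 hxc), hm c, add_zero]
        · intro h
          have hc' := mem_movedCycles.1 hc
          obtain ⟨y, _, h1, h2⟩ := exists_mem_of_chain hc'.1 (chain_and hc'.1 hc'.2.2 h) hxc
          rw [← h1.2] at h2
          exact hxE h2
        · rw [if_pos hx, hw _ _ hxE]
      · push Not at hc
        refine mul_eq_zero_of_right _ (Finset.prod_eq_zero (i := x) ?_ ?_)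
        · simpa using hc
        · rw [if_pos hx, hw _ _ hxE]
  · intro ρ f
    simp only [Finset.mem_filter, Finset.mem_univ, true_and]
    constructor
    · rintro ⟨h1, h2, h3⟩
      exact ⟨h3, h2⟩
    · rintro ⟨h1, h2⟩
      refine ⟨fun x hx => ?_, h2, h1⟩
      by_contra hn
      exact hn ((h1 x hn).symm.trans (h2 x hx))

/-! ### Weights of cycles -/

theorem closedProd_congr {V R : Type*} [Monoid R] {r : V → V → Prop} {M M' : V → V → R}
    (h : ∀ x y, r x y → M x y = M' x y) {l : List V} (hl : (l : Cycle V).Chain r) :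
    closedProd M l = closedProd M' l := by
  rw [chain_coe_iff] at hl
  unfold closedProd
  congr 1
  apply List.ext_getElem (by simp)
  intro i h1 h2
  rw [List.getElem_zipWith, List.getElem_zipWith, List.getElem_rotate]
  exact h _ _ (hl i (by simpa using h1))

theorem cycleTrace_congr {V R S : Type*} [Monoid R] (τ : R → S)
    (hτ : ∀ x y, τ (x * y) = τ (y * x)) {r : V → V → Prop} {M M' : V → V → R}
    (h : ∀ x y, r x y → M x y = M' x y) {c : Cycle V} (hc : c.Chain r) :
    cycleTrace τ hτ M c = cycleTrace τ hτ M' c := by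
  induction c using Quotient.inductionOn' with
  | h l => exact congrArg τ (closedProd_congr h hc)

theorem prod_zipWith_mul {V S : Type*} [CommMonoid S] (u v : V → V → S) (l₁ l₂ : List V) :
    (List.zipWith (fun i j => u i j * v i j) l₁ l₂).prod =
      (List.zipWith u l₁ l₂).prod * (List.zipWith v l₁ l₂).prod := by
  induction l₁ generalizing l₂ with
  | nil => simp
  | cons a l ih =>
    cases l₂ with
    | nil => simp
    | cons b l' => simp [ih, mul_mul_mul_comm]

theorem cycleWeight_mul {V S : Type*} [CommMonoid S] (u v : V → V → S) (c : Cycle V) :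
    cycleWeight (fun i j => u i j * v i j) c = cycleWeight u c * cycleWeight v c := by
  induction c using Quotient.inductionOn' with
  | h l => exact prod_zipWith_mul u v l _

theorem cycleWeight_map_hom {V S T : Type*} [CommMonoid S] [CommMonoid T] (φ : S →* T)
    (u : V → V → S) (c : Cycle V) :
    cycleWeight (fun i j => φ (u i j)) c = φ (cycleWeight u c) := by
  induction c using Quotient.inductionOn' with
  | h l =>
    change closedProd _ l = φ (closedProd _ l)
    rw [closedProd, closedProd, map_list_prod, List.map_zipWith]

theorem prod_zipWith_tmul {V K H S : Type*} [CommRing K] [Ring H] [Algebra K H] [CommRing S]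
    [Algebra K S] (b : V → V → S) (h : V → V → H) (l₁ l₂ : List V) :
    (List.zipWith (fun i j => b i j ⊗ₜ[K] h i j) l₁ l₂).prod =
      (List.zipWith b l₁ l₂).prod ⊗ₜ[K] (List.zipWith h l₁ l₂).prod := by
  induction l₁ generalizing l₂ with
  | nil => simp [Algebra.TensorProduct.one_def]
  | cons a l ih =>
    cases l₂ with
    | nil => simp [Algebra.TensorProduct.one_def]
    | cons b l' => simp [ih]

theorem cycleTrace_tmul {V K H S : Type*} [CommRing K] [Ring H] [Algebra K H] [CommRing S]
    [Algebra K S] (τ : H →ₗ[K] K) (hτ : ∀ x y, τ (x * y) = τ (y * x)) (b : V → V → S)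
    (h : V → V → H) (c : Cycle V) :
    cycleTrace (extTrace S τ) (extTrace_comm S τ hτ) (fun i j => b i j ⊗ₜ[K] h i j) c =
      algebraMap K S (cycleTrace τ hτ h c) * cycleWeight b c := by
  induction c using Quotient.inductionOn' with
  | h l =>
    change extTrace S τ (closedProd _ l) = algebraMap K S (τ (closedProd h l)) * closedProd b l
    rw [closedProd, prod_zipWith_tmul, extTrace_tmul, Algebra.smul_def]
    rfl

theorem cycleTrace_smul {V K H : Type*} [CommRing K] [Ring H] [Algebra K H]
    (τ : H →ₗ[K] K) (hτ : ∀ x y, τ (x * y) = τ (y * x)) (b : V → V → K)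
    (h : V → V → H) (c : Cycle V) :
    cycleTrace τ hτ (fun i j => b i j • h i j) c = cycleWeight b c * cycleTrace τ hτ h c := by
  have key : ∀ l₁ l₂ : List V, (List.zipWith (fun i j => b i j • h i j) l₁ l₂).prod =
      (List.zipWith b l₁ l₂).prod • (List.zipWith h l₁ l₂).prod := by
    intro l₁
    induction l₁ with
    | nil => simp
    | cons a l ih =>
      intro l₂
      cases l₂ with
      | nil => simp
      | cons b l' => simp [ih, smul_smul, mul_comm]
  induction c using Quotient.inductionOn' with
  | h l =>
    change τ (closedProd _ l) = closedProd b l * τ (closedProd h l)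
    rw [closedProd, key, map_smul, smul_eq_mul]
    rfl

/-! ### The determinant as a sum over forests -/

/-- Used to ensure that only off-diagonal entries of a matrix occur along a moved cycle. -/
theorem chain_ne_of_nontrivial {V : Type*} [DecidableEq V] {c : Cycle V} (hc : c.Nodup)
    (hn : c.Nontrivial) : c.Chain (fun i j => i ≠ j) := by
  have h2 := Cycle.length_nontrivial hn
  induction c using Quotient.inductionOn' with
  | h l =>
    change (l : Cycle V).Chain _
    change 2 ≤ l.length at h2
    rw [chain_coe_iff]
    intro i hi h
    have := (List.Nodup.getElem_inj_iff hc).1 h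
    rcases Nat.lt_or_ge (i + 1) l.length with h' | h'
    · rw [Nat.mod_eq_of_lt h'] at this
      omega
    · have e : i + 1 = l.length := by omega
      rw [e, Nat.mod_self] at this
      omega

/-- The weight `w` splits the traces of the diagonal entries, while `a` comes from the off-diagonal
entries. They are kept separate because the same diagonal can be split in several ways, for instance
over fewer edges or with an extra scalar. -/
theorem tauDet_eq_sum_forests {ι X K H S : Type*} [Fintype ι] [DecidableEq ι] [Fintype X]
    [DecidableEq X] [CommRing K] [Ring H] [Algebra K H] [CommRing S] [Algebra K S]
    (τ : H →ₗ[K] K) (hτ : ∀ x y, τ (x * y) = τ (y * x))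
    {E : Finset (X × X)} (hE : ∀ e ∈ E, e.1 ≠ e.2) (e : ι ↪ X) (W : Finset X)
    (hW : ∀ x, x ∈ W ↔ x ∈ Set.range e) (w a : X → X → S)
    (hw : ∀ x y, (x, y) ∉ E → w x y = 0) (ha : ∀ x y, (x, y) ∉ E → a x y = 0)
    (h : X → X → H) (M : Matrix ι ι (S ⊗[K] H))
    (hdiag : ∀ i, extTrace S τ (M i i) = ∑ y, w (e i) y)
    (hoff : ∀ i j, i ≠ j → M i j = -(a (e i) (e j) ⊗ₜ[K] h (e i) (e j))) :
    tauDet (extTrace S τ) (extTrace_comm S τ hτ) M =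
      ∑ F ∈ forests E W, (∏ c ∈ cyclesOf F,
        (-(algebraMap K S (cycleTrace τ hτ h c) * cycleWeight a c) + cycleWeight w c)) *
      ∏ e ∈ branches F, w e.1 e.2 := by
  classical
  rw [tauDet_eq_sum_movedCycles, ← sum_perm_eq_sum_forests hE W _ w hw
    (fun c hc => by rw [cycleWeight_eq_zero ha hc, mul_zero, neg_zero]),
    ← sum_perm_embedding e W hW _ (fun x => ∑ y, w x y)]
  refine Finset.sum_congr rfl fun σ _ => ?_
  congr 1
  · refine Finset.prod_congr rfl fun c hc => ?_
    have hc' := mem_movedCycles.1 hc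
    have hne := chain_ne_of_nontrivial hc'.1 (movedCycles_nontrivial hc)
    have e1 : cycleTrace (extTrace S τ) (extTrace_comm S τ hτ) M c =
        cycleTrace (extTrace S τ) (extTrace_comm S τ hτ)
          (fun i j => ((-1) * a (e i) (e j)) ⊗ₜ[K] h (e i) (e j)) c := by
      refine cycleTrace_congr _ _ (r := fun i j => i ≠ j) (fun i j hij => ?_) hne
      rw [hoff i j hij, neg_one_mul, TensorProduct.neg_tmul]
    rw [e1, cycleTrace_tmul τ hτ (fun i j => (-1) * a (e i) (e j)) (fun i j => h (e i) (e j)),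
      cycleWeight_mul (fun _ _ => -1) (fun i j => a (e i) (e j)), cycleWeight_const,
      cycleTrace_map τ hτ h e]
    have e2 : cycleWeight (fun i j => a (e i) (e j)) c = cycleWeight a (c.map e) :=
      cycleTrace_map _ _ a e c
    rw [e2]
    -- The sign of the cycle and the signs of its entries cancel up to a single `-1`.
    have e3 : ((-1 : S) ^ c.length) * (-1) ^ c.length = 1 := by
      rw [← mul_pow]
      simp
    linear_combination (-(algebraMap K S (cycleTrace τ hτ h (c.map e)) *
      cycleWeight a (c.map e))) * e3
  · exact Finset.prod_congr rfl fun i _ => hdiag i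

open Classical in
-- A forest has `|W|` edges, so one factor `s` per edge comes out as `s ^ |W|`, and each trace term
-- pays `r ^ ℓ(c)` for it. A branch edge outside `P` kills the whole term, whereas a cycle leaving
-- `P` loses only its weight term and keeps its trace term.
theorem sum_forests_uniform {X S : Type*} [Fintype X] [DecidableEq X] [CommRing S]
    {E : Finset (X × X)} (hE : ∀ e ∈ E, e.1 ≠ e.2) (W : Finset X) (P : X → X → Prop)
    (a : X → X → S) (s r : S) (hsr : s * r = 1) (g : Cycle X → S) :
    (∑ F ∈ forests E W, (∏ c ∈ cyclesOf F, (-(g c * cycleWeight a c) +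
        cycleWeight (fun x y => s * (if P x y then a x y else 0)) c)) *
      ∏ e ∈ branches F, (s * (if P e.1 e.2 then a e.1 e.2 else 0))) =
    s ^ W.card * ∑ F ∈ (forests E W).filter (fun F => ∀ e ∈ branches F, P e.1 e.2),
      (∏ e ∈ F, a e.1 e.2) *
        ∏ c ∈ cyclesOf F, ((if c.Chain P then 1 else 0) - r ^ c.length * g c) := by
  rw [Finset.mul_sum, Finset.sum_filter]
  refine Finset.sum_congr rfl fun F hF => ?_
  by_cases hP : ∀ e ∈ branches F, P e.1 e.2
  · rw [if_pos hP]
    have e1 : s ^ W.card = (∏ c ∈ cyclesOf F, s ^ c.length) * ∏ e ∈ branches F, s := by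
      rw [← card_forest hF, ← Finset.prod_const, prod_forest_eq hE hF (fun _ _ => s)]
      simp only [cycleWeight_const]
    rw [e1, prod_forest_eq hE hF a]
    have e2 : ∏ e ∈ branches F, (s * (if P e.1 e.2 then a e.1 e.2 else 0)) =
        (∏ e ∈ branches F, s) * ∏ e ∈ branches F, a e.1 e.2 := by
      rw [← Finset.prod_mul_distrib]
      exact Finset.prod_congr rfl fun e he => by rw [if_pos (hP e he)]
    have e3 : ∏ c ∈ cyclesOf F, (-(g c * cycleWeight a c) +
        cycleWeight (fun x y => s * (if P x y then a x y else 0)) c) =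
        (∏ c ∈ cyclesOf F, s ^ c.length) * (∏ c ∈ cyclesOf F, cycleWeight a c) *
          ∏ c ∈ cyclesOf F, ((if c.Chain P then 1 else 0) - r ^ c.length * g c) := by
      rw [← Finset.prod_mul_distrib, ← Finset.prod_mul_distrib]
      refine Finset.prod_congr rfl fun c _ => ?_
      have e4 : s ^ c.length * r ^ c.length = 1 := by rw [← mul_pow, hsr, one_pow]
      rw [cycleWeight_mul (fun _ _ => s), cycleWeight_const]
      by_cases hc : c.Chain P
      · have e5 : cycleWeight (fun x y => if P x y then a x y else 0) c = cycleWeight a c :=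
          cycleTrace_congr _ _ (fun x y h => if_pos h) hc
        rw [if_pos hc, e5]
        linear_combination (cycleWeight a c * g c) * e4
      · rw [if_neg hc, cycleWeight_eq_zero (fun x y h => if_neg h) hc]
        linear_combination (cycleWeight a c * g c) * e4
    rw [e2, e3]
    ring
  · rw [if_neg hP]
    push Not at hP
    obtain ⟨e, he, hPe⟩ := hP
    rw [Finset.prod_eq_zero he, mul_zero]
    rw [if_neg hPe, mul_zero]

/-! ### Laplacians -/

theorem edgeVar_eq_zero {V K : Type*} [DecidableEq V] [CommRing K] {E : Finset (V × V)} {i j : V}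
    (h : (i, j) ∉ E) : edgeVar K E i j = 0 := dif_neg h

open Classical in
theorem tauDet_laplacian {V K H : Type*} [Fintype V] [DecidableEq V] [CommRing K] [Ring H]
    [Algebra K H] (τ : H →ₗ[K] K) (hτ : ∀ x y, τ (x * y) = τ (y * x))
    {E : Finset (V × V)} (hE : ∀ e ∈ E, e.1 ≠ e.2) (W : Finset V)
    (h : V → V → H) (M : Matrix W W (WeightRing K E ⊗[K] H)) (s r : K) (hsr : s * r = 1)
    (hdiag : ∀ i : W, extTrace (WeightRing K E) τ (M i i) =
      algebraMap K (WeightRing K E) s * ∑ k, edgeVar K E i k)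
    (hoff : ∀ i j : W, i ≠ j → M i j = -(edgeVar K E i j ⊗ₜ[K] h i j)) :
    tauDet (extTrace (WeightRing K E) τ) (extTrace_comm _ τ hτ) M =
      algebraMap K (WeightRing K E) (s ^ W.card) * ∑ F ∈ forests E W,
        forestWeight K E F * ∏ c ∈ cyclesOf F,
          (1 - algebraMap K (WeightRing K E) (r ^ c.length * cycleTrace τ hτ h c)) := by
  have hsr' : algebraMap K (WeightRing K E) s * algebraMap K (WeightRing K E) r = 1 := by
    rw [← map_mul, hsr, map_one]
  -- No edge is excluded here; the predicate stays opaque so that the conditionals keep the shape of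
  -- `sum_forests_uniform`.
  obtain ⟨P, hP⟩ : ∃ P : V → V → Prop, ∀ x y, P x y := ⟨fun _ _ => True, fun _ _ => trivial⟩
  rw [tauDet_eq_sum_forests τ hτ hE (Function.Embedding.subtype (· ∈ W)) W (by simp)
    (fun x y => algebraMap K (WeightRing K E) s * (if P x y then edgeVar K E x y else 0))
    (edgeVar K E) (fun x y hxy => by simp [edgeVar_eq_zero hxy])
    (fun x y hxy => edgeVar_eq_zero hxy) h M
    (fun i => by rw [hdiag, Finset.mul_sum]; simp [hP]) hoff]
  have := sum_forests_uniform hE W P (edgeVar K E)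
    (algebraMap K (WeightRing K E) s) (algebraMap K (WeightRing K E) r) hsr'
    (fun c => algebraMap K (WeightRing K E) (cycleTrace τ hτ h c))
  rw [this, map_pow]
  refine congrArg (HMul.hMul _) ?_
  refine Finset.sum_congr (by simp [hP]) fun F _ => ?_
  refine congrArg (HMul.hMul _) (Finset.prod_congr rfl fun c _ => ?_)
  rw [map_mul, map_pow, if_pos]
  exact (Cycle.chain_of_pairwise fun _ _ _ _ => hP _ _)

theorem mem_colouredEdges {V : Type*} [Fintype V] [DecidableEq V] {E : Finset (V × V)} {N : ℕ}
    {p q : V × Fin N} : (p, q) ∈ colouredEdges E N ↔ (p.1, q.1) ∈ E := by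
  simp [colouredEdges]

theorem colouredEdges_loopless {V : Type*} [Fintype V] [DecidableEq V] {E : Finset (V × V)}
    (hE : ∀ e ∈ E, e.1 ≠ e.2) (N : ℕ) : ∀ e ∈ colouredEdges E N, e.1 ≠ e.2 := by
  rintro ⟨p, q⟩ he h
  exact hE _ (mem_colouredEdges.1 he) (congrArg Prod.fst h)

open Classical in
-- The hypothesis `hdiag` is the freedom in the argument: it spreads one diagonal entry over the
-- coloured edges allowed by `P`.
theorem tauDet_blockLaplacian {V K H : Type*} [Fintype V] [DecidableEq V] [CommRing K] [Ring H]
    [Algebra K H] (τ : H →ₗ[K] K) (hτ : ∀ x y, τ (x * y) = τ (y * x))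
    {E : Finset (V × V)} (hE : ∀ e ∈ E, e.1 ≠ e.2) (W : Finset V) (N : ℕ)
    (h : V → V → Matrix (Fin N) (Fin N) H) (P : V × Fin N → V × Fin N → Prop)
    (s r : K) (hsr : s * r = 1)
    (hdiag : ∀ p : V × Fin N, algebraMap K (WeightRing K E) (τ 1) * ∑ k, edgeVar K E p.1 k =
      algebraMap K (WeightRing K E) s *
        ∑ q : V × Fin N, if P p q then edgeVar K E p.1 q.1 else 0) :
    tauDet (extTrace (WeightRing K E) τ) (extTrace_comm _ τ hτ)
      ((blockLaplacian E h).submatrix (Prod.map Subtype.val id : W × Fin N → V × Fin N)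
        (Prod.map Subtype.val id : W × Fin N → V × Fin N)) =
      algebraMap K (WeightRing K E) (s ^ (W.card * N)) *
        ∑ F ∈ (colouredForests E W N).filter (fun F => ∀ e ∈ branches F, P e.1 e.2),
        colouredForestWeight K E F * ∏ c ∈ cyclesOf F, ((if c.Chain P then 1 else 0) -
          algebraMap K (WeightRing K E) (r ^ c.length * cycleTrace τ hτ (colouredHol h) c)) := by
  have hsr' : algebraMap K (WeightRing K E) s * algebraMap K (WeightRing K E) r = 1 := by
    rw [← map_mul, hsr, map_one]
  have hcE := colouredEdges_loopless hE N
  have hinj : Function.Injective (Prod.map Subtype.val id : W × Fin N → V × Fin N) :=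
    Subtype.val_injective.prodMap Function.injective_id
  have hzero : ∀ p q : V × Fin N, (p, q) ∉ colouredEdges E N → edgeVar K E p.1 q.1 = 0 :=
    fun p q hpq => edgeVar_eq_zero (fun h => hpq (mem_colouredEdges.2 h))
  rw [tauDet_eq_sum_forests τ hτ hcE ⟨_, hinj⟩ (W ×ˢ Finset.univ) (by simp)
    (fun x y => algebraMap K (WeightRing K E) s * (if P x y then edgeVar K E x.1 y.1 else 0))
    (fun x y => edgeVar K E x.1 y.1) (fun x y hxy => by simp [hzero x y hxy])
    hzero (colouredHol h)]
  · have := sum_forests_uniform hcE (W ×ˢ Finset.univ) P (fun x y => edgeVar K E x.1 y.1)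
      (algebraMap K (WeightRing K E) s) (algebraMap K (WeightRing K E) r) hsr'
      (fun c => algebraMap K (WeightRing K E) (cycleTrace τ hτ (colouredHol h) c))
    rw [this, map_pow, Finset.card_product, Finset.card_univ, Fintype.card_fin]
    refine congrArg (HMul.hMul _) ?_
    refine Finset.sum_congr rfl fun F _ => ?_
    refine congrArg (HMul.hMul _) (Finset.prod_congr rfl fun c _ => ?_)
    rw [map_mul, map_pow]
  · intro p
    rw [← Finset.mul_sum]
    have hp : (blockLaplacian E h).submatrix (Prod.map Subtype.val id : W × Fin N → V × Fin N)
        (Prod.map Subtype.val id : W × Fin N → V × Fin N) p p =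
        (∑ k, edgeVar K E p.1 k) ⊗ₜ[K] (1 : H) := by
      simp [blockLaplacian]
    rw [hp, extTrace_tmul, Algebra.smul_def]
    exact hdiag (p.1, p.2)
  · intro p q hpq
    simp only [blockLaplacian, Matrix.submatrix_apply, Matrix.of_apply, Function.Embedding.coeFn_mk,
      Prod.map_fst, Prod.map_snd, id]
    -- Between two colours of one vertex the entry is 0, which has the required form because `a_{ii}
    -- = 0` in a loopless graph.
    by_cases h1 : (p.1 : V) = q.1
    · have h2 : p.2 ≠ q.2 := fun h2 => hpq (Prod.ext (Subtype.ext h1) h2)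
      rw [if_pos h1, if_neg h2, h1, edgeVar_eq_zero (fun h => hE _ h rfl)]
      simp
    · rw [if_neg h1]

/-! ### Reversal of cycles -/

theorem reverse_ne_self {V : Type*} {c : Cycle V} (hc : c.Nodup) (h3 : 3 ≤ c.length) :
    c.reverse ≠ c := by
  intro h
  induction c using Quotient.inductionOn' with
  | h l =>
    have hl : l.Nodup := hc
    have h3' : 3 ≤ l.length := h3
    obtain ⟨n, hn⟩ := Cycle.coe_eq_coe.1 (show ((l.reverse : List V) : Cycle V) = l from h)
    have hn' : ∀ i (hi : i < l.length), (l.reverse.rotate n)[i]'(by simpa using hi) = l[i] := by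
      intro i hi
      simp only [hn]
    -- Reversal followed by rotation decreases indices modulo the length, so it cannot fix both 0
    -- and 1 unless the length is at most 2.
    have e : ∀ i (hi : i < l.length), l.length - 1 - (i + n) % l.length = i := by
      intro i hi
      have := hn' i hi
      rw [List.getElem_rotate, List.getElem_reverse] at this
      simpa using (List.Nodup.getElem_inj_iff hl).1 this
    have e0 := e 0 (by omega)
    have e1 := e 1 (by omega)
    rw [Nat.add_comm, ← Nat.mod_add_mod] at e1
    have hlt := Nat.mod_lt n (show 0 < l.length by omega)
    rw [Nat.zero_add] at e0
    have e2 : n % l.length = l.length - 1 := by omega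
    rw [e2, show l.length - 1 + 1 = l.length by omega, Nat.mod_self] at e1
    omega

theorem reverse_eq_self {V : Type*} {c : Cycle V} (h2 : c.length = 2) : c.reverse = c := by
  induction c using Quotient.inductionOn' with
  | h l =>
    obtain ⟨a, b, rfl⟩ := List.length_eq_two.1 (show l.length = 2 from h2)
    exact Cycle.coe_eq_coe.2 ⟨1, by simp⟩

theorem mem_reverseAlong {V : Type*} [DecidableEq V] {F : Finset (V × V)} {c : Cycle V}
    {x y : V} : (x, y) ∈ reverseAlong F c ↔
      ((x, y) ∈ F ∧ x ∉ c) ∨ ((y, x) ∈ F ∧ y ∈ c) := by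
  simp only [reverseAlong, Finset.mem_union, Finset.mem_filter, Finset.mem_image, Prod.exists,
    Prod.swap_prod_mk, Prod.mk.injEq]
  constructor
  · rintro (h | ⟨a, b, h, rfl, rfl⟩)
    · exact Or.inl h
    · exact Or.inr h
  · rintro (h | h)
    · exact Or.inl h
    · exact Or.inr ⟨y, x, h, rfl, rfl⟩

section Reversal

variable {V : Type*} [Fintype V] [DecidableEq V] {E : Finset (V × V)} {W : Finset V}
  {F : Finset (V × V)} {c : Cycle V}

theorem mem_cycle_of_edge (hF : F ∈ forests E W) (hc : c ∈ cyclesOf F) {x y : V}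
    (h : (x, y) ∈ F) (hx : x ∈ c) : y ∈ c := by
  rw [mem_cyclesOf] at hc
  obtain ⟨z, hz, h'⟩ := exists_mem_of_chain hc.1 hc.2.2 hx
  rwa [forests_functional hF x y z h h']

/-- A vertex of `c` exchanges its unique successor for its unique predecessor on `c`; other vertices
keep their edge. -/
theorem reverseAlong_mem_forests (hE : ∀ e ∈ E, e.swap ∈ E) (hF : F ∈ forests E W)
    (hc : c ∈ cyclesOf F) : reverseAlong F c ∈ forests E W := by
  have hF' := mem_forests.1 hF
  have hc' := mem_cyclesOf.1 hc
  rw [mem_forests]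
  refine ⟨?_, ?_, ?_⟩
  · rintro ⟨x, y⟩ h
    rcases mem_reverseAlong.1 h with h | h
    · exact hF'.1 h.1
    · exact hE _ (hF'.1 h.1)
  · rintro ⟨x, y⟩ h
    rcases mem_reverseAlong.1 h with h | h
    · exact hF'.2.1 _ h.1
    · obtain ⟨z, _, hz⟩ := exists_mem_of_chain hc'.1 hc'.2.2 (mem_cycle_of_edge hF hc h.1 h.2)
      have := hF'.2.1 _ hz
      exact this
  · intro i hi
    by_cases hic : i ∈ c
    · obtain ⟨y, hy, h⟩ := exists_mem_of_chain' hc'.1 hc'.2.2 hic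
      refine ⟨(i, y), ⟨mem_reverseAlong.2 (Or.inr ⟨h, hy⟩), rfl⟩, ?_⟩
      rintro ⟨i', y'⟩ ⟨h', rfl⟩
      rcases mem_reverseAlong.1 h' with h' | h'
      · exact absurd hic h'.2
      · rw [eq_of_chain_of_mem (forests_functional hF) hc'.1 hc'.2.2 h'.2 hy h'.1 h]
    · obtain ⟨⟨i', y⟩, ⟨h, rfl⟩, _⟩ := hF'.2.2 i hi
      refine ⟨(i', y), ⟨mem_reverseAlong.2 (Or.inl ⟨h, hic⟩), rfl⟩, ?_⟩
      rintro ⟨i'', y'⟩ ⟨h', rfl⟩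
      rcases mem_reverseAlong.1 h' with h' | h'
      · rw [forests_functional hF _ _ _ h'.1 h]
      · exact absurd (mem_cycle_of_edge hF hc h'.1 h'.2) hic

/-- In a forest, cycles sharing a vertex coincide. A cycle of the new forest that meets `c` is
therefore `c.reverse`, and one that avoids `c` uses only unchanged edges. -/
theorem cyclesOf_reverseAlong (hF : F ∈ forests E W) (hc : c ∈ cyclesOf F)
    (hF' : reverseAlong F c ∈ forests E W) :
    cyclesOf (reverseAlong F c) = insert c.reverse ((cyclesOf F).erase c) := by
  have hc' := mem_cyclesOf.1 hc
  have hrev : c.reverse ∈ cyclesOf (reverseAlong F c) := by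
    rw [mem_cyclesOf]
    refine ⟨Cycle.nodup_reverse_iff.2 hc'.1, ?_, ?_⟩
    · obtain ⟨x, hx⟩ := exists_mem_of_ne_nil hc'.2.1
      exact ne_nil_of_mem (Cycle.mem_reverse_iff.2 hx)
    · exact (chain_reverse hc'.1 hc'.2.2).imp fun x y h => mem_reverseAlong.2 (Or.inr h)
  ext d
  rw [Finset.mem_insert, Finset.mem_erase]
  constructor
  · intro hd
    by_cases h : ∃ x ∈ d, x ∈ c
    · obtain ⟨x, hx, hxc⟩ := h
      exact Or.inl (cyclesOf_eq_of_mem hF' hd hrev hx (Cycle.mem_reverse_iff.2 hxc))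
    · push Not at h
      right
      have hd' := mem_cyclesOf.1 hd
      refine ⟨?_, mem_cyclesOf.2 ⟨hd'.1, hd'.2.1, chain_imp_mem hd'.1 hd'.2.2 ?_⟩⟩
      · rintro rfl
        obtain ⟨x, hx⟩ := exists_mem_of_ne_nil hd'.2.1
        exact h x hx hx
      · intro x hx y hy hxy
        rcases mem_reverseAlong.1 hxy with h' | h'
        · exact h'.1
        · exact absurd h'.2 (h y hy)
  · rintro (rfl | ⟨hne, hd⟩)
    · exact hrev
    · have hd' := mem_cyclesOf.1 hd
      refine mem_cyclesOf.2 ⟨hd'.1, hd'.2.1, chain_imp_mem hd'.1 hd'.2.2 fun x hx y _ hxy => ?_⟩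
      exact mem_reverseAlong.2 (Or.inl ⟨hxy, fun hxc => hne (cyclesOf_eq_of_mem hF hd hc hx hxc)⟩)

theorem branches_reverseAlong (hF : F ∈ forests E W) (hc : c ∈ cyclesOf F)
    (hF' : reverseAlong F c ∈ forests E W) : branches (reverseAlong F c) = branches F := by
  ext ⟨x, y⟩
  rw [mem_branches, mem_branches, cyclesOf_reverseAlong hF hc hF', mem_reverseAlong]
  constructor
  · rintro ⟨h1, h2⟩
    have hxc : x ∉ c := fun h => h2 _ (Finset.mem_insert_self _ _) (Cycle.mem_reverse_iff.2 h)
    refine ⟨?_, fun d hd => ?_⟩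
    · rcases h1 with h1 | h1
      · exact h1.1
      · exact absurd (mem_cycle_of_edge hF hc h1.1 h1.2) hxc
    · by_cases hdc : d = c
      · rwa [hdc]
      · exact h2 d (Finset.mem_insert_of_mem (Finset.mem_erase.2 ⟨hdc, hd⟩))
  · rintro ⟨h1, h2⟩
    refine ⟨Or.inl ⟨h1, h2 c hc⟩, fun d hd => ?_⟩
    rcases Finset.mem_insert.1 hd with rfl | hd
    · exact fun h => h2 c hc (Cycle.mem_reverse_iff.1 h)
    · exact h2 d (Finset.mem_of_mem_erase hd)

theorem prod_reverseAlong {S : Type*} [CommMonoid S] (hF : F ∈ forests E W) (hc : c ∈ cyclesOf F)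
    (g : V × V → S) (hg : ∀ e ∈ F, g e.swap = g e) :
    ∏ e ∈ reverseAlong F c, g e = ∏ e ∈ F, g e := by
  classical
  unfold reverseAlong
  rw [Finset.prod_union, Finset.prod_image Prod.swap_injective.injOn,
    Finset.prod_congr rfl fun e he => hg e (Finset.mem_filter.1 he).1, mul_comm,
    Finset.prod_filter_mul_prod_filter_not]
  rw [Finset.disjoint_left]
  intro e he he'
  obtain ⟨e', h', rfl⟩ := Finset.mem_image.1 he'
  rw [Finset.mem_filter] at h' he
  exact he.2 (mem_cycle_of_edge hF hc h'.1 h'.2)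

/-- A forest is determined by its branches and its cycles. -/
theorem subset_of_branches_cyclesOf {F' : Finset (V × V)} (hF : F ∈ forests E W)
    (hb : branches F = branches F') (hc : cyclesOf F = cyclesOf F') : F ⊆ F' := by
  rintro ⟨x, y⟩ h
  by_cases hx : ∃ c ∈ cyclesOf F, x ∈ c
  · obtain ⟨c, hcF, hx⟩ := hx
    have h1 := mem_cyclesOf.1 hcF
    have h2 := mem_cyclesOf.1 (hc ▸ hcF)
    obtain ⟨z, _, hz, hz'⟩ := exists_mem_of_chain h1.1 (chain_and h1.1 h1.2.2 h2.2.2) hx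
    rwa [forests_functional hF x y z h hz]
  · push Not at hx
    have : (x, y) ∈ branches F' := hb ▸ mem_branches.2 ⟨h, hx⟩
    exact (mem_branches.1 this).1

theorem two_le_length (hE : ∀ e ∈ E, e.1 ≠ e.2) (hF : F ∈ forests E W) (hc : c ∈ cyclesOf F) :
    2 ≤ c.length := by
  rw [mem_cyclesOf] at hc
  refine Cycle.length_nontrivial (nontrivial_of_chain_ne ?_ hc.1 hc.2.1 hc.2.2)
  exact fun x hx => hE _ ((mem_forests.1 hF).1 hx) rfl

end Reversal

/-! ### Sums over unoriented forests -/

section Unoriented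

variable {V : Type*} [Fintype V] [DecidableEq V] {E : Finset (V × V)} {W : Finset V}
  {P : Finset (Finset (V × V))}

/-- The branches and the cycles up to orientation survive each elementary reversal; they are enough
to describe a whole class. -/
theorem invariants_of_equiv (hP : ∀ F ∈ P, F ∈ forests E W)
    (hrev : ∀ F ∈ P, ∀ c ∈ cyclesOf F, reverseAlong F c ∈ P) {F F' : P}
    (h : (reversalSetoid P).r F F') : branches F.1 = branches F'.1 ∧
      ∀ c, (c ∈ cyclesOf F.1 ∨ c.reverse ∈ cyclesOf F.1) ↔
        (c ∈ cyclesOf F'.1 ∨ c.reverse ∈ cyclesOf F'.1) := by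
  induction h with
  | rel F F' h =>
    obtain ⟨c, hc, h⟩ := h
    have h1 := hP _ F.2
    have h2 := hP _ (hrev _ F.2 c hc)
    rw [h, branches_reverseAlong h1 hc h2]
    refine ⟨rfl, fun d => ?_⟩
    rw [cyclesOf_reverseAlong h1 hc h2]
    simp only [Finset.mem_insert, Finset.mem_erase]
    by_cases h3 : d = c
    · subst h3
      simp [hc]
    · by_cases h4 : d.reverse = c
      · subst h4
        simp [hc]
      · have h5 : d ≠ c.reverse := fun h5 => h4 (by rw [h5, Cycle.reverse_reverse])
        have h6 : d.reverse ≠ c.reverse := fun h6 =>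
          h3 (by rw [← Cycle.reverse_reverse d, h6, Cycle.reverse_reverse])
        simp [h3, h4, h5, h6]
  | refl F => exact ⟨rfl, fun _ => Iff.rfl⟩
  | symm F F' _ ih => exact ⟨ih.1.symm, fun c => (ih.2 c).symm⟩
  | trans F F' F'' _ _ ih ih' => exact ⟨ih.1.trans ih'.1, fun c => (ih.2 c).trans (ih'.2 c)⟩

theorem weight_eq_of_equiv {S : Type*} {A : Finset (V × V) → S}
    (hA : ∀ F ∈ P, ∀ c ∈ cyclesOf F, A (reverseAlong F c) = A F) {F F' : P}
    (h : (reversalSetoid P).r F F') : A F.1 = A F'.1 := by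
  induction h with
  | rel F F' h =>
    obtain ⟨c, hc, h⟩ := h
    rw [h, hA _ F.2 c hc]
  | refl F => rfl
  | symm F F' _ ih => exact ih.symm
  | trans F F' F'' _ _ ih ih' => exact ih.trans ih'

/-- A cycle and its reverse have the same vertices, so a forest containing both contains a single
cycle. -/
theorem eq_of_reverse_eq_of_mem {F : Finset (V × V)} (hF : F ∈ forests E W) {c d : Cycle V}
    (hc : c ∈ cyclesOf F) (hd : d ∈ cyclesOf F) (h : c = d.reverse) : c = d := by
  obtain ⟨x, hx⟩ := exists_mem_of_ne_nil (mem_cyclesOf.1 hc).2.1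
  refine cyclesOf_eq_of_mem hF hc hd hx ?_
  rw [h] at hx
  exact Cycle.mem_reverse_iff.1 hx

theorem exists_reversed (hP : ∀ F ∈ P, F ∈ forests E W)
    (hrev : ∀ F ∈ P, ∀ c ∈ cyclesOf F, reverseAlong F c ∈ P) (F₀ : P) (D : Finset (Cycle V))
    (hD : D ⊆ cyclesOf F₀.1) : ∃ F : P, (reversalSetoid P).r F₀ F ∧
      cyclesOf F.1 = (cyclesOf F₀.1 \ D) ∪ D.image Cycle.reverse := by
  induction D using Finset.induction_on with
  | empty => exact ⟨F₀, Relation.EqvGen.refl _, by simp⟩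
  | insert c D hc ih =>
    obtain ⟨F, h1, h2⟩ := ih ((Finset.subset_insert _ _).trans hD)
    have hc₀ : c ∈ cyclesOf F₀.1 := hD (Finset.mem_insert_self _ _)
    have hcF : c ∈ cyclesOf F.1 := by
      rw [h2, Finset.mem_union, Finset.mem_sdiff]
      exact Or.inl ⟨hc₀, hc⟩
    have hF' := hrev _ F.2 c hcF
    refine ⟨⟨reverseAlong F.1 c, hF'⟩, h1.trans _ _ _ (Relation.EqvGen.rel _ _ ⟨c, hcF, rfl⟩), ?_⟩
    rw [cyclesOf_reverseAlong (hP _ F.2) hcF (hP _ hF'), h2]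
    have hcD : c ∉ D.image Cycle.reverse := by
      intro h
      obtain ⟨d, hd, h⟩ := Finset.mem_image.1 h
      have := eq_of_reverse_eq_of_mem (hP _ F₀.2) hc₀ (hD (Finset.mem_insert_of_mem hd)) h.symm
      exact hc (this ▸ hd)
    ext d
    simp only [Finset.mem_insert, Finset.mem_erase, Finset.mem_union, Finset.mem_sdiff,
      Finset.image_insert]
    by_cases hdc : d = c
    · subst hdc
      simp [hcD]
    · simp only [hdc, not_false_eq_true, true_and, false_or, ne_eq]
      exact or_left_comm

/-- The set `D` of reversed cycles needs only lengths at least 3: a 2-cycle equals its reverse and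
belongs to every forest of the class. -/
theorem cyclesOf_eq_of_equiv (hE : ∀ e ∈ E, e.1 ≠ e.2) (hP : ∀ F ∈ P, F ∈ forests E W)
    (hrev : ∀ F ∈ P, ∀ c ∈ cyclesOf F, reverseAlong F c ∈ P) {F₀ F : P}
    (h : (reversalSetoid P).r F₀ F) (D : Finset (Cycle V))
    (hD : ∀ c, c ∈ D ↔ (c ∈ cyclesOf F₀.1 ∧ 3 ≤ c.length) ∧ c ∉ cyclesOf F.1) :
    cyclesOf F.1 = (cyclesOf F₀.1 \ D) ∪ D.image Cycle.reverse := by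
  have hinv := (invariants_of_equiv hP hrev h).2
  have hmem : ∀ d ∈ cyclesOf F₀.1, d ∉ D → d ∈ cyclesOf F.1 := by
    intro d hd hdD
    by_contra hn
    have hlen : d.length = 2 := by
      have := two_le_length hE (hP _ F₀.2) hd
      by_contra h2
      exact hdD ((hD d).2 ⟨⟨hd, by omega⟩, hn⟩)
    rcases (hinv d).1 (Or.inl hd) with h1 | h1
    · exact hn h1
    · rw [reverse_eq_self hlen] at h1
      exact hn h1
  ext c
  simp only [Finset.mem_union, Finset.mem_sdiff, Finset.mem_image]
  constructor
  · intro hc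
    rcases (hinv c).2 (Or.inl hc) with h1 | h1
    · exact Or.inl ⟨h1, fun hcD => ((hD c).1 hcD).2 hc⟩
    · by_cases h2 : c.reverse ∈ D
      · exact Or.inr ⟨_, h2, Cycle.reverse_reverse c⟩
      · have h3 := hmem _ h1 h2
        have h4 := eq_of_reverse_eq_of_mem (hP _ F.2) h3 hc rfl
        rw [h4] at h1 h2
        exact Or.inl ⟨h1, h2⟩
  · rintro (h1 | ⟨d, hd, rfl⟩)
    · exact hmem _ h1.1 h1.2
    · have hd' := (hD d).1 hd
      exact ((hinv d).1 (Or.inl hd'.1.1)).resolve_left hd'.2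

/-- The class of `F₀` is parametrised by the set of long cycles whose orientation is changed. The
reversed term stands first in the sum because `Finset.prod_add` attaches the first summand to the
chosen subset. -/
theorem sum_class_eq {S : Type*} [CommRing S] (hE : ∀ e ∈ E, e.1 ≠ e.2)
    (hP : ∀ F ∈ P, F ∈ forests E W)
    (hrev : ∀ F ∈ P, ∀ c ∈ cyclesOf F, reverseAlong F c ∈ P) (φ : Cycle V → S) (F₀ : P)
    (p : P → Prop) [DecidablePred p] (hp : ∀ F, p F ↔ (reversalSetoid P).r F₀ F) :
    ∑ F ∈ (Finset.univ : Finset P).filter p, ∏ c ∈ cyclesOf F.1, φ c =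
      (∏ c ∈ (cyclesOf F₀.1).filter (fun c => c.length = 2), φ c) *
      ∏ c ∈ (cyclesOf F₀.1).filter (fun c => 3 ≤ c.length), (φ c.reverse + φ c) := by
  classical
  rw [Finset.prod_add, Finset.mul_sum]
  refine Finset.sum_bij (fun F _ => ((cyclesOf F₀.1).filter (fun c => 3 ≤ c.length)).filter
    (fun c => c ∉ cyclesOf F.1)) ?_ ?_ ?_ ?_
  · intro F _
    exact Finset.mem_powerset.2 (Finset.filter_subset _ _)
  · intro F hF F' hF' h
    have h1 := (hp F).1 (Finset.mem_filter.1 hF).2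
    have h1' := (hp F').1 (Finset.mem_filter.1 hF').2
    have e := cyclesOf_eq_of_equiv hE hP hrev h1
      (((cyclesOf F₀.1).filter (fun c => 3 ≤ c.length)).filter (fun c => c ∉ cyclesOf F.1))
      (fun c => by rw [Finset.mem_filter, Finset.mem_filter])
    have e' := cyclesOf_eq_of_equiv hE hP hrev h1'
      (((cyclesOf F₀.1).filter (fun c => 3 ≤ c.length)).filter (fun c => c ∉ cyclesOf F'.1))
      (fun c => by rw [Finset.mem_filter, Finset.mem_filter])
    rw [h, ← e'] at e
    have eb := (invariants_of_equiv hP hrev h1).1.symm.trans (invariants_of_equiv hP hrev h1').1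
    -- Equal sets of reversed cycles give equal cycles, the branches are common to the class, and
    -- the two together determine a forest.
    exact Subtype.ext (Finset.Subset.antisymm (subset_of_branches_cyclesOf (hP _ F.2) eb e)
      (subset_of_branches_cyclesOf (hP _ F'.2) eb.symm e.symm))
  · intro D hD
    rw [Finset.mem_powerset] at hD
    have hD' : ∀ c ∈ D, c ∈ cyclesOf F₀.1 ∧ 3 ≤ c.length := fun c hc =>
      Finset.mem_filter.1 (hD hc)
    obtain ⟨F, h1, h2⟩ := exists_reversed hP hrev F₀ D (fun c hc => (hD' c hc).1)
    refine ⟨F, Finset.mem_filter.2 ⟨Finset.mem_univ _, (hp F).2 h1⟩, ?_⟩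
    ext c
    rw [Finset.mem_filter, Finset.mem_filter, h2, Finset.mem_union, Finset.mem_sdiff,
      Finset.mem_image]
    constructor
    · rintro ⟨⟨h3, _⟩, h4⟩
      by_contra hn
      exact h4 (Or.inl ⟨h3, hn⟩)
    · intro hc
      refine ⟨hD' c hc, ?_⟩
      rintro (h3 | ⟨d, hd, h3⟩)
      · exact h3.2 hc
      · have h4 := eq_of_reverse_eq_of_mem (hP _ F₀.2) (hD' c hc).1 (hD' d hd).1 h3.symm
        subst h4
        exact reverse_ne_self (mem_cyclesOf.1 (hD' c hc).1).1 (hD' c hc).2 h3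
  · intro F hF
    have h1 := (hp F).1 (Finset.mem_filter.1 hF).2
    set L := (cyclesOf F₀.1).filter (fun c => 3 ≤ c.length) with hL
    set D := L.filter (fun c => c ∉ cyclesOf F.1) with hD
    have hDL : D ⊆ L := Finset.filter_subset _ _
    have hDc : ∀ c ∈ D, c ∈ cyclesOf F₀.1 ∧ 3 ≤ c.length := fun c hc =>
      Finset.mem_filter.1 (hDL hc)
    have e := cyclesOf_eq_of_equiv hE hP hrev h1 D (fun c => by
      rw [Finset.mem_filter, Finset.mem_filter])
    rw [e, Finset.prod_union, Finset.prod_image]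
    · have e2 : cyclesOf F₀.1 \ D =
          (cyclesOf F₀.1).filter (fun c => c.length = 2) ∪ (L \ D) := by
        ext c
        simp only [Finset.mem_sdiff, Finset.mem_union, Finset.mem_filter, hL]
        constructor
        · rintro ⟨h2, h3⟩
          have := two_le_length hE (hP _ F₀.2) h2
          rcases this.eq_or_lt with h4 | h4
          · exact Or.inl ⟨h2, h4.symm⟩
          · exact Or.inr ⟨⟨h2, h4⟩, h3⟩
        · rintro (⟨h2, h3⟩ | ⟨⟨h2, h3⟩, h4⟩)
          · refine ⟨h2, fun h => ?_⟩
            have := (hDc c h).2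
            omega
          · exact ⟨h2, h4⟩
      rw [e2, Finset.prod_union]
      · ring
      · rw [Finset.disjoint_left]
        intro c hc hc'
        have h2 := (Finset.mem_filter.1 hc).2
        have h3 := (Finset.mem_filter.1 (Finset.mem_sdiff.1 hc').1).2
        omega
    · intro c _ d _ h
      rw [← Cycle.reverse_reverse c, h, Cycle.reverse_reverse]
    · rw [Finset.disjoint_left]
      intro c hc hc'
      rw [Finset.mem_sdiff] at hc
      obtain ⟨d, hd, h⟩ := Finset.mem_image.1 hc'
      have := eq_of_reverse_eq_of_mem (hP _ F₀.2) hc.1 (hDc d hd).1 h.symm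
      exact hc.2 (this ▸ hd)

/-- A sum over oriented forests as a sum over unoriented forests. -/
theorem sum_eq_sum_unoriented {S : Type*} [CommRing S] (hE : ∀ e ∈ E, e.1 ≠ e.2)
    (hP : ∀ F ∈ P, F ∈ forests E W)
    (hrev : ∀ F ∈ P, ∀ c ∈ cyclesOf F, reverseAlong F c ∈ P) (A : Finset (V × V) → S)
    (hA : ∀ F ∈ P, ∀ c ∈ cyclesOf F, A (reverseAlong F c) = A F) (φ : Cycle V → S)
    (rep : Unoriented P → P) (hrep : ∀ q, Quotient.mk _ (rep q) = q) :
    ∑ F ∈ P, A F * ∏ c ∈ cyclesOf F, φ c =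
      ∑ q : Unoriented P, A (rep q).1 *
        ((∏ c ∈ (cyclesOf (rep q).1).filter (fun c => c.length = 2), φ c) *
        ∏ c ∈ (cyclesOf (rep q).1).filter (fun c => 3 ≤ c.length), (φ c + φ c.reverse)) := by
  classical
  rw [← Finset.sum_coe_sort P, ← Finset.sum_fiberwise (Finset.univ : Finset P)
    (fun F => (Quotient.mk _ F : Unoriented P))]
  refine Finset.sum_congr rfl fun q _ => ?_
  have hp : ∀ F : P, (Quotient.mk _ F : Unoriented P) = q ↔ (reversalSetoid P).r (rep q) F := by
    intro F
    rw [← Quotient.eq, hrep, eq_comm]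
  have := sum_class_eq hE hP hrev φ (rep q) _ hp
  have hcomm : ∀ c : Cycle V, φ c + φ c.reverse = φ c.reverse + φ c := fun c => add_comm _ _
  simp only [hcomm]
  rw [← this, Finset.mul_sum]
  refine Finset.sum_congr rfl fun F hF => ?_
  rw [weight_eq_of_equiv hA ((hp F).1 (Finset.mem_filter.1 hF).2)]

end Unoriented

/-! ### Symmetric weights -/

theorem mk_edgeVar_swap {V K : Type*} [DecidableEq V] [CommRing K] {E : Finset (V × V)}
    {e : V × V} (he : e ∈ E) :
    Ideal.Quotient.mk (symmIdeal K E) (edgeVar K E e.2 e.1) =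
      Ideal.Quotient.mk (symmIdeal K E) (edgeVar K E e.1 e.2) :=
  (Ideal.Quotient.eq.2 (show edgeVar K E e.1 e.2 - edgeVar K E e.2 e.1 ∈ symmIdeal K E from
    Ideal.subset_span ⟨e, he, rfl⟩)).symm

theorem mk_forestWeight_reverseAlong {V K : Type*} [Fintype V] [DecidableEq V] [CommRing K]
    {E : Finset (V × V)} {W : Finset V} {F : Finset (V × V)} (hF : F ∈ forests E W)
    {c : Cycle V} (hc : c ∈ cyclesOf F) :
    Ideal.Quotient.mk (symmIdeal K E) (forestWeight K E (reverseAlong F c)) =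
      Ideal.Quotient.mk (symmIdeal K E) (forestWeight K E F) := by
  rw [forestWeight, forestWeight, map_prod, map_prod]
  exact prod_reverseAlong hF hc
    (fun e => Ideal.Quotient.mk (symmIdeal K E) (edgeVar K E e.1 e.2))
    (fun e he => mk_edgeVar_swap ((mem_forests.1 hF).1 he))

theorem mk_colouredForestWeight_reverseAlong {V K : Type*} [Fintype V] [DecidableEq V]
    [CommRing K] {E : Finset (V × V)} {W : Finset V} {N : ℕ}
    {F : Finset ((V × Fin N) × (V × Fin N))} (hF : F ∈ colouredForests E W N)
    {c : Cycle (V × Fin N)} (hc : c ∈ cyclesOf F) :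
    Ideal.Quotient.mk (symmIdeal K E) (colouredForestWeight K E (reverseAlong F c)) =
      Ideal.Quotient.mk (symmIdeal K E) (colouredForestWeight K E F) := by
  rw [colouredForestWeight, colouredForestWeight, map_prod, map_prod]
  refine prod_reverseAlong hF hc
    (fun e => Ideal.Quotient.mk (symmIdeal K E) (edgeVar K E e.1.1 e.2.1)) ?_
  rintro ⟨p, q⟩ he
  exact mk_edgeVar_swap (mem_colouredEdges.1 ((mem_forests.1 hF).1 he))

theorem colouredEdges_symm {V : Type*} [Fintype V] [DecidableEq V] {E : Finset (V × V)}
    (hE : ∀ e ∈ E, e.swap ∈ E) (N : ℕ) : ∀ e ∈ colouredEdges E N, e.swap ∈ colouredEdges E N := by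
  rintro ⟨p, q⟩ he
  exact mem_colouredEdges.2 (hE _ (mem_colouredEdges.1 he))

/-! ### Horizontal forests -/

/-- Having the same colour is transitive, so it is enough to compare consecutive vertices. -/
theorem isHorizontal_iff_chain {V : Type*} {N : ℕ} {c : Cycle (V × Fin N)} :
    IsHorizontal c ↔ c.Chain (fun p q => p.2 = q.2) := by
  have : IsTrans (V × Fin N) (fun p q => p.2 = q.2) := ⟨fun _ _ _ h h' => h.trans h'⟩
  exact Cycle.chain_iff_pairwise.symm

theorem isHorizontal_reverse {V : Type*} {N : ℕ} {c : Cycle (V × Fin N)} :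
    IsHorizontal c.reverse ↔ IsHorizontal c := by
  simp [IsHorizontal]

theorem mem_horizontalForests {V : Type*} [Fintype V] [DecidableEq V] {E : Finset (V × V)}
    {W : Finset V} {N : ℕ} {F : Finset ((V × Fin N) × (V × Fin N))} :
    F ∈ horizontalForests E W N ↔ F ∈ colouredForests E W N ∧
      ∀ e ∈ branches F, e.1.2 = e.2.2 := by
  rw [horizontalForests, Finset.mem_filter]
  refine and_congr_right fun _ => forall_congr' fun e => ?_
  rw [mem_branches, and_imp]

theorem reverseAlong_mem_horizontalForests {V : Type*} [Fintype V] [DecidableEq V]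
    {E : Finset (V × V)} (hE : ∀ e ∈ E, e.swap ∈ E) {W : Finset V} {N : ℕ}
    {F : Finset ((V × Fin N) × (V × Fin N))} (hF : F ∈ horizontalForests E W N)
    {c : Cycle (V × Fin N)} (hc : c ∈ cyclesOf F) :
    reverseAlong F c ∈ horizontalForests E W N := by
  rw [mem_horizontalForests] at hF ⊢
  have hF' := reverseAlong_mem_forests (colouredEdges_symm hE N) hF.1 hc
  refine ⟨hF', ?_⟩
  rw [branches_reverseAlong hF.1 hc hF']
  exact hF.2

open Classical in
theorem prod_cyclesOf_eq_horizontal_mul_slanted {V S : Type*} [Fintype V] [DecidableEq V]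
    [CommMonoid S] {N : ℕ} (F : Finset ((V × Fin N) × (V × Fin N)))
    (ψ ψ₁ ψ₂ : Cycle (V × Fin N) → S) (h₁ : ∀ c, IsHorizontal c → ψ c = ψ₁ c)
    (h₂ : ∀ c, ¬ IsHorizontal c → ψ c = ψ₂ c) (p : Cycle (V × Fin N) → Prop) [DecidablePred p] :
    ∏ c ∈ (cyclesOf F).filter p, ψ c =
      (∏ c ∈ (horizontalCycles F).filter p, ψ₁ c) * ∏ c ∈ (slantedCycles F).filter p, ψ₂ c := by
  rw [← Finset.prod_filter_mul_prod_filter_not _ (fun c => IsHorizontal c)]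
  refine congrArg₂ (· * ·) (Finset.prod_congr ?_ ?_) (Finset.prod_congr ?_ ?_)
  · rw [Finset.filter_comm, horizontalCycles]
  · exact fun c hc => h₁ c (Finset.mem_filter.1 (Finset.mem_filter.1 hc).1).2
  · rw [Finset.filter_comm, slantedCycles]
  · exact fun c hc => h₂ c (Finset.mem_filter.1 (Finset.mem_filter.1 hc).1).2

open Classical in
-- With `P` the equality of colours, each edge leaving a vertex has exactly one horizontal lift from
-- a given colour, so the diagonal entry is unchanged and `s = τ(1)`.
theorem tauDet_blockLaplacian_horizontal {V K H : Type*} [Fintype V] [DecidableEq V] [CommRing K]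
    [Ring H] [Algebra K H] (τ : H →ₗ[K] K) (hτ : ∀ x y, τ (x * y) = τ (y * x))
    {E : Finset (V × V)} (hE : ∀ e ∈ E, e.1 ≠ e.2) (W : Finset V) (N : ℕ)
    (h : V → V → Matrix (Fin N) (Fin N) H) (t : Kˣ) (ht : (t : K) = τ 1) :
    tauDet (extTrace (WeightRing K E) τ) (extTrace_comm _ τ hτ)
      ((blockLaplacian E h).submatrix (Prod.map Subtype.val id : W × Fin N → V × Fin N)
        (Prod.map Subtype.val id : W × Fin N → V × Fin N)) =
      MvPolynomial.C (τ 1 ^ (N * W.card)) * ∑ F ∈ horizontalForests E W N,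
        colouredForestWeight K E F * ∏ c ∈ cyclesOf F, ((if IsHorizontal c then 1 else 0) -
          MvPolynomial.C ((↑(t⁻¹) : K) ^ c.length * cycleTrace τ hτ (colouredHol h) c)) := by
  obtain ⟨P, hP⟩ : ∃ P : V × Fin N → V × Fin N → Prop, ∀ p q, P p q ↔ p.2 = q.2 :=
    ⟨fun p q => p.2 = q.2, fun _ _ => Iff.rfl⟩
  have hif : ∀ c : Cycle (V × Fin N), (if IsHorizontal c then (1 : WeightRing K E) else 0) =
      if c.Chain P then 1 else 0 := by
    intro c
    have hc : IsHorizontal c ↔ c.Chain P := by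
      rw [isHorizontal_iff_chain]
      exact ⟨Cycle.Chain.imp fun p q => (hP p q).2, Cycle.Chain.imp fun p q => (hP p q).1⟩
    exact if_congr hc rfl rfl
  have e : horizontalForests E W N =
      (colouredForests E W N).filter (fun F => ∀ e ∈ branches F, P e.1 e.2) := by
    ext F
    rw [mem_horizontalForests, Finset.mem_filter]
    simp only [hP]
  rw [tauDet_blockLaplacian τ hτ hE W N h P (τ 1) (↑(t⁻¹) : K)
    (by rw [← ht, Units.mul_inv]), MvPolynomial.algebraMap_eq, mul_comm N, e]
  · simp only [hif]
  · intro p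
    rw [Fintype.sum_prod_type]
    simp [hP]

/-! ### Specialisations: all coloured forests, signs, unoriented forests -/

theorem algebraMap_mul_sum_edgeVar {V K : Type*} [Fintype V] [DecidableEq V] [CommRing K]
    (E : Finset (V × V)) (N : ℕ) (x s : K) (hx : x = s * N) (p : V × Fin N) :
    algebraMap K (WeightRing K E) x * ∑ k, edgeVar K E p.1 k =
      algebraMap K (WeightRing K E) s * ∑ q : V × Fin N, edgeVar K E p.1 q.1 := by
  rw [Fintype.sum_prod_type, hx, map_mul, map_natCast, mul_assoc,
    Finset.mul_sum _ _ (N : WeightRing K E)]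
  simp

/-- Every edge has `N` lifts from a given coloured vertex, hence `τ 1 = s * N`. Taking `s` as data
instead of a quotient lets `s = 1` be used when `N` is not invertible. -/
theorem tauDet_blockLaplacian_coloured {V K H : Type*} [Fintype V] [DecidableEq V] [CommRing K]
    [Ring H] [Algebra K H] (τ : H →ₗ[K] K) (hτ : ∀ x y, τ (x * y) = τ (y * x))
    {E : Finset (V × V)} (hE : ∀ e ∈ E, e.1 ≠ e.2) (W : Finset V) (N : ℕ)
    (h : V → V → Matrix (Fin N) (Fin N) H) (s r : K) (hsr : s * r = 1) (hs : τ 1 = s * N) :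
    tauDet (extTrace (WeightRing K E) τ) (extTrace_comm _ τ hτ)
      ((blockLaplacian E h).submatrix (Prod.map Subtype.val id : W × Fin N → V × Fin N)
        (Prod.map Subtype.val id : W × Fin N → V × Fin N)) =
      MvPolynomial.C (s ^ (W.card * N)) * ∑ F ∈ colouredForests E W N,
        colouredForestWeight K E F * ∏ c ∈ cyclesOf F, (1 -
          MvPolynomial.C (r ^ c.length * cycleTrace τ hτ (colouredHol h) c)) := by
  classical
  obtain ⟨P, hP⟩ : ∃ P : V × Fin N → V × Fin N → Prop, ∀ x y, P x y :=
    ⟨fun _ _ => True, fun _ _ => trivial⟩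
  have hchain : ∀ c : Cycle (V × Fin N), c.Chain P := fun c =>
    Cycle.chain_of_pairwise fun _ _ _ _ => hP _ _
  rw [tauDet_blockLaplacian τ hτ hE W N h P s r hsr
    (by simpa only [hP, if_true] using algebraMap_mul_sum_edgeVar E N _ s hs),
    MvPolynomial.algebraMap_eq]
  have e : (colouredForests E W N).filter (fun F => ∀ e ∈ branches F, P e.1 e.2) =
      colouredForests E W N := Finset.filter_true_of_mem fun _ _ _ _ => hP _ _
  rw [e]
  simp only [hchain, if_true]

/-- The signs are absorbed into the holonomies, which reduces the signed Laplacian to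
`tauDet_laplacian`. -/
theorem cycleTrace_sign_smul {V K H : Type*} [CommRing K] [Ring H] [Algebra K H]
    (τ : H →ₗ[K] K) (hτ : ∀ x y, τ (x * y) = τ (y * x)) (ε : V → V → ℤˣ) (h : V → V → H)
    (c : Cycle V) : cycleTrace τ hτ (fun i j => ((ε i j : ℤ) : K) • h i j) c =
      ((cycleSign ε c : ℤ) : K) * cycleTrace τ hτ h c := by
  rw [cycleTrace_smul]
  congr 1
  exact cycleWeight_map_hom
    ((Int.castRingHom K).toMonoidHom.comp (Units.coeHom ℤ) : ℤˣ →* K) ε c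

theorem extTrace_laplacian_diag {V K H : Type*} [Fintype V] [DecidableEq V] [CommRing K]
    [Ring H] [Algebra K H] (τ : H →ₗ[K] K) (E : Finset (V × V)) (x : WeightRing K E) :
    extTrace (WeightRing K E) τ (x ⊗ₜ[K] (1 : H)) = algebraMap K (WeightRing K E) (τ 1) * x := by
  rw [extTrace_tmul, Algebra.smul_def]

theorem tauDet_laplacian_forests {V K H : Type*} [Fintype V] [DecidableEq V] [CommRing K]
    [Ring H] [Algebra K H] (τ : H →ₗ[K] K) (hτ : ∀ x y, τ (x * y) = τ (y * x))
    {E : Finset (V × V)} (hE : ∀ e ∈ E, e.1 ≠ e.2) (W : Finset V) (h : V → V → H) (t : Kˣ)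
    (ht : (t : K) = τ 1) :
    tauDet (extTrace (WeightRing K E) τ) (extTrace_comm _ τ hτ)
      ((laplacian E h).submatrix (Subtype.val : W → V) (Subtype.val : W → V)) =
      MvPolynomial.C (τ 1 ^ W.card) * ∑ F ∈ forests E W,
        forestWeight K E F * ∏ c ∈ cyclesOf F,
          (1 - MvPolynomial.C ((↑(t⁻¹) : K) ^ c.length * cycleTrace τ hτ h c)) := by
  rw [tauDet_laplacian τ hτ hE W h _ (τ 1) (↑(t⁻¹) : K) (by rw [← ht, Units.mul_inv]),
    MvPolynomial.algebraMap_eq]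
  · intro i
    rw [Matrix.submatrix_apply, laplacian, Matrix.of_apply, if_pos rfl, extTrace_laplacian_diag]
  · intro i j hij
    rw [Matrix.submatrix_apply, laplacian, Matrix.of_apply,
      if_neg (Subtype.val_injective.ne hij)]

theorem tauDet_signedLaplacian {V K H : Type*} [Fintype V] [DecidableEq V] [CommRing K]
    [Ring H] [Algebra K H] (τ : H →ₗ[K] K) (hτ : ∀ x y, τ (x * y) = τ (y * x))
    {E : Finset (V × V)} (hE : ∀ e ∈ E, e.1 ≠ e.2) (W : Finset V) (h : V → V → H)
    (ε : V → V → ℤˣ) (d : ℕ) (u t : Kˣ) (hu : (u : K) = (d : K)) (ht : (t : K) = τ 1) :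
    tauDet (extTrace (WeightRing K E) τ) (extTrace_comm _ τ hτ)
      ((signedLaplacian E u ε h).submatrix (Subtype.val : W → V) (Subtype.val : W → V)) =
      MvPolynomial.C ((τ 1 * (↑(u⁻¹) : K)) ^ W.card) * ∑ F ∈ forests E W,
        forestWeight K E F * ∏ c ∈ cyclesOf F,
          (1 - MvPolynomial.C (((d : K) * (↑(t⁻¹) : K)) ^ c.length *
            ((cycleSign ε c : ℤ) : K) * cycleTrace τ hτ h c)) := by
  rw [tauDet_laplacian τ hτ hE W (fun i j => ((ε i j : ℤ) : K) • h i j) _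
    (τ 1 * (↑(u⁻¹) : K)) ((d : K) * (↑(t⁻¹) : K)), MvPolynomial.algebraMap_eq]
  · simp only [cycleTrace_sign_smul, mul_assoc]
  · rw [← ht, ← hu, mul_assoc, Units.inv_mul_cancel_left, Units.mul_inv]
  · intro i
    rw [Matrix.submatrix_apply, signedLaplacian, Matrix.of_apply, if_pos rfl,
      extTrace_laplacian_diag, map_mul, mul_assoc]
    rfl
  · intro i j hij
    rw [Matrix.submatrix_apply, signedLaplacian, Matrix.of_apply,
      if_neg (Subtype.val_injective.ne hij), TensorProduct.tmul_smul, TensorProduct.smul_tmul',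
      Algebra.smul_def, map_intCast]

theorem mk_tauDet_laplacian_unoriented {V K H : Type*} [Fintype V] [DecidableEq V] [CommRing K]
    [Ring H] [Algebra K H] (τ : H →ₗ[K] K) (hτ : ∀ x y, τ (x * y) = τ (y * x))
    {E : Finset (V × V)} (hE : ∀ e ∈ E, e.1 ≠ e.2) (hsymm : ∀ e ∈ E, e.swap ∈ E)
    (W : Finset V) (h : V → V → H) (t : Kˣ) (ht : (t : K) = τ 1)
    (rep : Unoriented (forests E W) → forests E W) (hrep : ∀ q, Quotient.mk _ (rep q) = q) :
    Ideal.Quotient.mk (symmIdeal K E)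
      (tauDet (extTrace (WeightRing K E) τ) (extTrace_comm _ τ hτ)
        ((laplacian E h).submatrix (Subtype.val : W → V) (Subtype.val : W → V))) =
      Ideal.Quotient.mk (symmIdeal K E)
        (MvPolynomial.C (τ 1 ^ W.card) * ∑ q : Unoriented (forests E W),
          forestWeight K E (rep q).1 *
          (∏ c ∈ (cyclesOf (rep q).1).filter (fun c => c.length = 2),
            (1 - MvPolynomial.C ((↑(t⁻¹) : K) ^ c.length * cycleTrace τ hτ h c))) *
          (∏ c ∈ (cyclesOf (rep q).1).filter (fun c => 3 ≤ c.length),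
            (2 - MvPolynomial.C ((↑(t⁻¹) : K) ^ c.length *
              (cycleTrace τ hτ h c + cycleTrace τ hτ h c.reverse))))) := by
  rw [tauDet_laplacian_forests τ hτ hE W h t ht, map_mul, map_mul]
  refine congrArg (HMul.hMul _) ?_
  rw [map_sum, map_sum]
  have key := sum_eq_sum_unoriented hE (fun F (hF : F ∈ forests E W) => hF)
    (fun F hF c hc => reverseAlong_mem_forests hsymm hF hc)
    (fun F => Ideal.Quotient.mk (symmIdeal K E) (forestWeight K E F))
    (fun F hF c hc => mk_forestWeight_reverseAlong hF hc)
    (fun c => Ideal.Quotient.mk (symmIdeal K E)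
      (1 - MvPolynomial.C ((↑(t⁻¹) : K) ^ c.length * cycleTrace τ hτ h c))) rep hrep
  simp only [map_mul (Ideal.Quotient.mk (symmIdeal K E)),
    map_prod (Ideal.Quotient.mk (symmIdeal K E))]
  rw [key]
  refine Finset.sum_congr rfl fun q _ => ?_
  rw [mul_assoc]
  refine congrArg (HMul.hMul _) (congrArg (HMul.hMul _) (Finset.prod_congr rfl fun c _ => ?_))
  rw [← map_add, Cycle.length_reverse, mul_add, MvPolynomial.C_add]
  refine congrArg _ ?_
  ring

/-- Reversal preserves horizontality of a cycle. In `φ(c) + φ(c⁻¹)` the constants therefore add up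
to 2 for a horizontal cycle and to 0 for a slanted one. -/
theorem mk_tauDet_blockLaplacian_unoriented {V K H : Type*} [Fintype V] [DecidableEq V]
    [CommRing K] [Ring H] [Algebra K H] (τ : H →ₗ[K] K) (hτ : ∀ x y, τ (x * y) = τ (y * x))
    {E : Finset (V × V)} (hE : ∀ e ∈ E, e.1 ≠ e.2) (hsymm : ∀ e ∈ E, e.swap ∈ E)
    (W : Finset V) (N : ℕ) (h : V → V → Matrix (Fin N) (Fin N) H) (t : Kˣ) (ht : (t : K) = τ 1)
    (rep : Unoriented (horizontalForests E W N) → horizontalForests E W N)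
    (hrep : ∀ q, Quotient.mk _ (rep q) = q) :
    Ideal.Quotient.mk (symmIdeal K E)
      (tauDet (extTrace (WeightRing K E) τ) (extTrace_comm _ τ hτ)
        ((blockLaplacian E h).submatrix (Prod.map Subtype.val id : W × Fin N → V × Fin N)
          (Prod.map Subtype.val id : W × Fin N → V × Fin N))) =
      Ideal.Quotient.mk (symmIdeal K E)
        (MvPolynomial.C (τ 1 ^ (N * W.card)) * ∑ q : Unoriented (horizontalForests E W N),
          colouredForestWeight K E (rep q).1 *
          (∏ c ∈ (horizontalCycles (rep q).1).filter (fun c => c.length = 2),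
            (1 - MvPolynomial.C ((↑(t⁻¹) : K) ^ c.length *
              cycleTrace τ hτ (colouredHol h) c))) *
          (∏ c ∈ (horizontalCycles (rep q).1).filter (fun c => 3 ≤ c.length),
            (2 - MvPolynomial.C ((↑(t⁻¹) : K) ^ c.length *
              (cycleTrace τ hτ (colouredHol h) c +
                cycleTrace τ hτ (colouredHol h) c.reverse)))) *
          (∏ c ∈ (slantedCycles (rep q).1).filter (fun c => c.length = 2),
            (-MvPolynomial.C ((↑(t⁻¹) : K) ^ c.length *
              cycleTrace τ hτ (colouredHol h) c))) *
          (∏ c ∈ (slantedCycles (rep q).1).filter (fun c => 3 ≤ c.length),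
            (-MvPolynomial.C ((↑(t⁻¹) : K) ^ c.length *
              (cycleTrace τ hτ (colouredHol h) c +
                cycleTrace τ hτ (colouredHol h) c.reverse))))) := by
  classical
  rw [tauDet_blockLaplacian_horizontal τ hτ hE W N h t ht, map_mul, map_mul]
  refine congrArg (HMul.hMul _) ?_
  rw [map_sum, map_sum]
  have key := sum_eq_sum_unoriented (colouredEdges_loopless hE N)
    (fun F (hF : F ∈ horizontalForests E W N) => (mem_horizontalForests.1 hF).1)
    (fun F hF c hc => reverseAlong_mem_horizontalForests hsymm hF hc)
    (fun F => Ideal.Quotient.mk (symmIdeal K E) (colouredForestWeight K E F))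
    (fun F hF c hc => mk_colouredForestWeight_reverseAlong (mem_horizontalForests.1 hF).1 hc)
    (fun c => Ideal.Quotient.mk (symmIdeal K E) ((if IsHorizontal c then 1 else 0) -
      MvPolynomial.C ((↑(t⁻¹) : K) ^ c.length * cycleTrace τ hτ (colouredHol h) c))) rep hrep
  simp only [map_mul (Ideal.Quotient.mk (symmIdeal K E)),
    map_prod (Ideal.Quotient.mk (symmIdeal K E))]
  rw [key]
  refine Finset.sum_congr rfl fun q _ => ?_
  rw [prod_cyclesOf_eq_horizontal_mul_slanted _ _
      (fun c => Ideal.Quotient.mk (symmIdeal K E) (1 -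
        MvPolynomial.C ((↑(t⁻¹) : K) ^ c.length * cycleTrace τ hτ (colouredHol h) c)))
      (fun c => Ideal.Quotient.mk (symmIdeal K E) (-
        MvPolynomial.C ((↑(t⁻¹) : K) ^ c.length * cycleTrace τ hτ (colouredHol h) c)))
      (fun c hc => by rw [if_pos hc]) (fun c hc => by rw [if_neg hc, zero_sub]),
    prod_cyclesOf_eq_horizontal_mul_slanted _ _
      (fun c => Ideal.Quotient.mk (symmIdeal K E) (2 -
        MvPolynomial.C ((↑(t⁻¹) : K) ^ c.length * (cycleTrace τ hτ (colouredHol h) c +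
          cycleTrace τ hτ (colouredHol h) c.reverse))))
      (fun c => Ideal.Quotient.mk (symmIdeal K E) (-
        MvPolynomial.C ((↑(t⁻¹) : K) ^ c.length * (cycleTrace τ hτ (colouredHol h) c +
          cycleTrace τ hτ (colouredHol h) c.reverse))))]
  · ring
  · intro c hc
    rw [if_pos hc, if_pos (isHorizontal_reverse.2 hc), ← map_add, Cycle.length_reverse, mul_add,
      MvPolynomial.C_add]
    refine congrArg _ ?_
    ring
  · intro c hc
    rw [if_neg hc, if_neg (isHorizontal_reverse.not.2 hc), ← map_add, Cycle.length_reverse,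
      mul_add, MvPolynomial.C_add]
    refine congrArg _ ?_
    ring

end TauDet

end

/-! ### The seven determinant formulas -/

theorem theoremA1 {K H V : Type*} [CommRing K] [Ring H] [Algebra K H] [Fintype V] [DecidableEq V]
    (τ : H →ₗ[K] K) (hτ : ∀ x y : H, τ (x * y) = τ (y * x))
    (E : Finset (V × V)) (hE : ∀ e ∈ E, e.1 ≠ e.2) (W : Finset V) :
    -- the main identity
    (∀ (h : V → V → H) (t : Kˣ), (t : K) = τ 1 →
      TauDet.tauDet (TauDet.extTrace (TauDet.WeightRing K E) τ) (TauDet.extTrace_comm _ τ hτ)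
          ((TauDet.laplacian E h).submatrix (Subtype.val : W → V) (Subtype.val : W → V))
        = MvPolynomial.C (τ 1 ^ W.card) * ∑ F ∈ TauDet.forests E W,
            TauDet.forestWeight K E F * ∏ c ∈ TauDet.cyclesOf F,
              (1 - MvPolynomial.C ((↑(t⁻¹) : K) ^ c.length * TauDet.cycleTrace τ hτ h c))) ∧
    -- symmetric weights
    ((∀ e ∈ E, e.swap ∈ E) → ∀ (h : V → V → H) (t : Kˣ), (t : K) = τ 1 →
      ∀ rep : TauDet.Unoriented (TauDet.forests E W) → TauDet.forests E W,
      (∀ q, Quotient.mk _ (rep q) = q) →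
      Ideal.Quotient.mk (TauDet.symmIdeal K E)
        (TauDet.tauDet (TauDet.extTrace (TauDet.WeightRing K E) τ) (TauDet.extTrace_comm _ τ hτ)
          ((TauDet.laplacian E h).submatrix (Subtype.val : W → V) (Subtype.val : W → V)))
        = Ideal.Quotient.mk (TauDet.symmIdeal K E)
          (MvPolynomial.C (τ 1 ^ W.card) * ∑ q : TauDet.Unoriented (TauDet.forests E W),
            TauDet.forestWeight K E (rep q).1 *
            (∏ c ∈ (TauDet.cyclesOf (rep q).1).filter (fun c => c.length = 2),
              (1 - MvPolynomial.C ((↑(t⁻¹) : K) ^ c.length * TauDet.cycleTrace τ hτ h c))) *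
            (∏ c ∈ (TauDet.cyclesOf (rep q).1).filter (fun c => 3 ≤ c.length),
              (2 - MvPolynomial.C ((↑(t⁻¹) : K) ^ c.length *
                (TauDet.cycleTrace τ hτ h c + TauDet.cycleTrace τ hτ h c.reverse)))))) ∧
    -- matrix holonomies, horizontal forests
    (∀ (N : ℕ) (h : V → V → Matrix (Fin N) (Fin N) H) (t : Kˣ), (t : K) = τ 1 →
      TauDet.tauDet (TauDet.extTrace (TauDet.WeightRing K E) τ) (TauDet.extTrace_comm _ τ hτ)
          ((TauDet.blockLaplacian E h).submatrix
            (Prod.map Subtype.val id : W × Fin N → V × Fin N)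
            (Prod.map Subtype.val id : W × Fin N → V × Fin N))
        = MvPolynomial.C (τ 1 ^ (N * W.card)) * ∑ F ∈ TauDet.horizontalForests E W N,
            TauDet.colouredForestWeight K E F *
            (∏ c ∈ TauDet.horizontalCycles F,
              (1 - MvPolynomial.C ((↑(t⁻¹) : K) ^ c.length *
                TauDet.cycleTrace τ hτ (TauDet.colouredHol h) c))) *
            (∏ c ∈ TauDet.slantedCycles F,
              (-MvPolynomial.C ((↑(t⁻¹) : K) ^ c.length *
                TauDet.cycleTrace τ hτ (TauDet.colouredHol h) c)))) ∧
    -- matrix holonomies, horizontal forests, symmetric weights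
    ((∀ e ∈ E, e.swap ∈ E) →
      ∀ (N : ℕ) (h : V → V → Matrix (Fin N) (Fin N) H) (t : Kˣ), (t : K) = τ 1 →
      ∀ rep : TauDet.Unoriented (TauDet.horizontalForests E W N) →
        TauDet.horizontalForests E W N,
      (∀ q, Quotient.mk _ (rep q) = q) →
      Ideal.Quotient.mk (TauDet.symmIdeal K E)
        (TauDet.tauDet (TauDet.extTrace (TauDet.WeightRing K E) τ) (TauDet.extTrace_comm _ τ hτ)
          ((TauDet.blockLaplacian E h).submatrix
            (Prod.map Subtype.val id : W × Fin N → V × Fin N)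
            (Prod.map Subtype.val id : W × Fin N → V × Fin N)))
        = Ideal.Quotient.mk (TauDet.symmIdeal K E)
          (MvPolynomial.C (τ 1 ^ (N * W.card)) *
            ∑ q : TauDet.Unoriented (TauDet.horizontalForests E W N),
            TauDet.colouredForestWeight K E (rep q).1 *
            (∏ c ∈ (TauDet.horizontalCycles (rep q).1).filter (fun c => c.length = 2),
              (1 - MvPolynomial.C ((↑(t⁻¹) : K) ^ c.length *
                TauDet.cycleTrace τ hτ (TauDet.colouredHol h) c))) *
            (∏ c ∈ (TauDet.horizontalCycles (rep q).1).filter (fun c => 3 ≤ c.length),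
              (2 - MvPolynomial.C ((↑(t⁻¹) : K) ^ c.length *
                (TauDet.cycleTrace τ hτ (TauDet.colouredHol h) c +
                  TauDet.cycleTrace τ hτ (TauDet.colouredHol h) c.reverse)))) *
            (∏ c ∈ (TauDet.slantedCycles (rep q).1).filter (fun c => c.length = 2),
              (-MvPolynomial.C ((↑(t⁻¹) : K) ^ c.length *
                TauDet.cycleTrace τ hτ (TauDet.colouredHol h) c))) *
            (∏ c ∈ (TauDet.slantedCycles (rep q).1).filter (fun c => 3 ≤ c.length),
              (-MvPolynomial.C ((↑(t⁻¹) : K) ^ c.length *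
                (TauDet.cycleTrace τ hτ (TauDet.colouredHol h) c +
                  TauDet.cycleTrace τ hτ (TauDet.colouredHol h) c.reverse)))))) ∧
    -- signs and multiplicity
    (∀ (h : V → V → H) (ε : V → V → ℤˣ) (d : ℕ) (u t : Kˣ), (u : K) = (d : K) → (t : K) = τ 1 →
      TauDet.tauDet (TauDet.extTrace (TauDet.WeightRing K E) τ) (TauDet.extTrace_comm _ τ hτ)
          ((TauDet.signedLaplacian E u ε h).submatrix
            (Subtype.val : W → V) (Subtype.val : W → V))
        = MvPolynomial.C ((τ 1 * (↑(u⁻¹) : K)) ^ W.card) * ∑ F ∈ TauDet.forests E W,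
            TauDet.forestWeight K E F * ∏ c ∈ TauDet.cyclesOf F,
              (1 - MvPolynomial.C (((d : K) * (↑(t⁻¹) : K)) ^ c.length *
                ((TauDet.cycleSign ε c : ℤ) : K) * TauDet.cycleTrace τ hτ h c))) ∧
    -- matrix holonomies, all coloured forests
    (∀ (N : ℕ) (h : V → V → Matrix (Fin N) (Fin N) H) (u t : Kˣ), (u : K) = (N : K) →
      (t : K) = τ 1 →
      TauDet.tauDet (TauDet.extTrace (TauDet.WeightRing K E) τ) (TauDet.extTrace_comm _ τ hτ)
          ((TauDet.blockLaplacian E h).submatrix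
            (Prod.map Subtype.val id : W × Fin N → V × Fin N)
            (Prod.map Subtype.val id : W × Fin N → V × Fin N))
        = MvPolynomial.C ((τ 1 * (↑(u⁻¹) : K)) ^ (W.card * N)) *
          ∑ F ∈ TauDet.colouredForests E W N,
            TauDet.colouredForestWeight K E F * ∏ c ∈ TauDet.cyclesOf F,
              (1 - MvPolynomial.C (((N : K) * (↑(t⁻¹) : K)) ^ c.length *
                TauDet.cycleTrace τ hτ (TauDet.colouredHol h) c))) ∧
    -- the case where the trace of the unit is `N`
    (∀ (N : ℕ) (h : V → V → Matrix (Fin N) (Fin N) H), τ 1 = (N : K) →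
      TauDet.tauDet (TauDet.extTrace (TauDet.WeightRing K E) τ) (TauDet.extTrace_comm _ τ hτ)
          ((TauDet.blockLaplacian E h).submatrix
            (Prod.map Subtype.val id : W × Fin N → V × Fin N)
            (Prod.map Subtype.val id : W × Fin N → V × Fin N))
        = ∑ F ∈ TauDet.colouredForests E W N,
            TauDet.colouredForestWeight K E F * ∏ c ∈ TauDet.cyclesOf F,
              (1 - MvPolynomial.C (TauDet.cycleTrace τ hτ (TauDet.colouredHol h) c))) := by
  refine ⟨?_, ?_, ?_, ?_, ?_, ?_, ?_⟩
  · exact fun h t ht => TauDet.tauDet_laplacian_forests τ hτ hE W h t ht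
  · exact fun hsymm h t ht rep hrep =>
      TauDet.mk_tauDet_laplacian_unoriented τ hτ hE hsymm W h t ht rep hrep
  · intro N h t ht
    classical
    rw [TauDet.tauDet_blockLaplacian_horizontal τ hτ hE W N h t ht]
    refine congrArg (HMul.hMul _) (Finset.sum_congr rfl fun F _ => ?_)
    have := TauDet.prod_cyclesOf_eq_horizontal_mul_slanted F
      (fun c => ((if TauDet.IsHorizontal c then 1 else 0) -
        MvPolynomial.C ((↑(t⁻¹) : K) ^ c.length *
          TauDet.cycleTrace τ hτ (TauDet.colouredHol h) c) : TauDet.WeightRing K E))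
      (fun c => 1 - MvPolynomial.C ((↑(t⁻¹) : K) ^ c.length *
          TauDet.cycleTrace τ hτ (TauDet.colouredHol h) c))
      (fun c => -MvPolynomial.C ((↑(t⁻¹) : K) ^ c.length *
          TauDet.cycleTrace τ hτ (TauDet.colouredHol h) c))
      (fun c hc => by rw [if_pos hc]) (fun c hc => by rw [if_neg hc, zero_sub]) (fun _ => True)
    simp only [Finset.filter_true] at this
    rw [this, mul_assoc]
  · exact fun hsymm N h t ht rep hrep =>
      TauDet.mk_tauDet_blockLaplacian_unoriented τ hτ hE hsymm W N h t ht rep hrep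
  · exact fun h ε d u t hu ht => TauDet.tauDet_signedLaplacian τ hτ hE W h ε d u t hu ht
  · intro N h u t hu ht
    refine TauDet.tauDet_blockLaplacian_coloured τ hτ hE W N h _ _ ?_ ?_
    · rw [← ht, ← hu, mul_assoc, Units.inv_mul_cancel_left, Units.mul_inv]
    · rw [← hu, mul_assoc, Units.inv_mul, mul_one]
  · intro N h hN
    -- Here `s = r = 1`: the trace of the unit exactly counts the lifts of an edge, and no inverse
    -- is needed.
    have := TauDet.tauDet_blockLaplacian_coloured τ hτ hE W N h 1 1 (one_mul 1)
      (by rw [hN, one_mul])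
    simpa only [one_pow, one_mul, MvPolynomial.C_1] using this
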